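/- Let $2^{<\omega}$ be the set of finite binary strings, $2^\omega$ the set of infinite binary sequences, $\preceq$ the initial segment relation, $\lambda$ the uniform (fair coin) measure on $2^\omega$, $[\![\sigma]\!]$ the set of sequences extending $\sigma$, and $[\![S]\!]=\bigcup_{\sigma\in S}[\![\sigma]\!]$ for $S\subseteq 2^{<\omega}$. A sequence is Martin-Löf random ($X\in\mathsf{MLR}$) if $X\notin\bigcap_i[\![S_i]\!]$ for every uniformly c.e. sequence $(S_i)_{i\in\omega}$ of sets of strings with $\lambda([\![S_i]\!])\le 2^{-i}$ for all $i$. A Turing functional is a c.e. set $\Phi$ of pairs of finite strings such that if $(\sigma,\tau),(\sigma',\tau')\in\Phi$ and $\sigma\preceq\sigma'$, then $\tau\preceq\tau'$ or $\tau'\preceq\tau$. For $X\in 2^\omega$, $\Phi^X$ is the (finite or infinite) sequence which is the supremum of all $\tau$ with $(\sigma,\tau)\in\Phi$ for some initial segment $\sigma$ of $X$; $\mathrm{dom}(\Phi)$ is the set of $X$ for which $\Phi^X$ is infinite, and then $\Phi(X):=\Phi^X$. For $A\subseteq 2^\omega$ put $\Phi(A)=\{\Phi(X): X\in A\cap\mathrm{dom}(\Phi)\}$.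 The semi-measure induced by $\Phi$ is $\lambda_\Phi(\tau)=\lambda([\![\{\sigma : (\sigma,\tau')\in\Phi\text{ for some }\tau'\succeq\tau\}]\!])$ for $\tau\in 2^{<\omega}$. A prefix-free machine is a partial computable map $M:\subseteq 2^{<\omega}\to 2^{<\omega}$ with prefix-free domain. A prefix-free machine $U$ is universal if for every prefix-free machine $M$ there is a constant $c$ such that whenever $M(\sigma)=v$ there is $\tau$ with $U(\tau)=v$ and $|\tau|\le|\sigma|+c$. For such $U$, Chaitin's $\Omega_U\in 2^\omega$ is the sequence of binary digits of the real $\sum_{U(\sigma)\downarrow}2^{-|\sigma|}$. Let $0^\omega$ be the all-zero sequence. **Theorem.** There are Turing functionals $\Phi$ and $\Psi$ such that $\lambda_\Phi=\lambda_\Psi$ and yet $\Phi(\mathsf{MLR})\neq\Psi(\mathsf{MLR})$. Moreover, universal prefix-free machines exist, and for every universal prefix-free machine $U$ such $\Phi$ and $\Psi$ can be chosen with $\mathrm{dom}(\Phi)=\{\Omega_U\}$, $\mathrm{dom}(\Psi)=\{0^\omega\}$ and $\Phi(\Omega_U)=\Psi(0^\omega)=0^\omega$. -/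

import Mathlib

open scoped ENNReal

/-- Cantor space `2^ω`: infinite binary sequences. Finite strings are `List Bool`, `0` is `false`. -/
abbrev Cantor : Type := ℕ → Bool

/-- `X ↾ n`, the string of the first `n` bits of `X`. -/
def Cantor.restrict (X : Cantor) (n : ℕ) : List Bool := (List.range n).map X

/-- The sequence `0^ω`. -/
def Cantor.zeros : Cantor := fun _ => false

/-- The cylinder `⟦σ⟧`: all sequences having `σ` as an initial segment. -/
def cylinder (σ : List Bool) : Set Cantor := {X | X.restrict σ.length = σ}

/-- `⟦S⟧`, the open set generated by a set `S` of strings. -/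
def openOf (S : Set (List Bool)) : Set Cantor := ⋃ σ ∈ S, cylinder σ

/-- The uniform (Lebesgue) measure on Cantor space: independent fair bits. -/
noncomputable def uniformMeasure : MeasureTheory.Measure Cantor :=
  MeasureTheory.Measure.infinitePi fun _ : ℕ => (PMF.uniformOfFintype Bool).toMeasure

theorem mem_cylinder_iff (X : Cantor) (σ : List Bool) :
    X ∈ cylinder σ ↔ ∀ i : Fin σ.length, X i = σ[i] := by
  constructor
  · intro h i
    have h2 : X.restrict σ.length = σ := h
    have h3 := List.getElem_of_eq h2 (i := i) (by simp [Cantor.restrict])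
    simpa [Cantor.restrict] using h3
  · intro h
    refine List.ext_getElem (by simp [Cantor.restrict]) ?_
    intro i h1 h2
    simpa [Cantor.restrict] using h ⟨i, h2⟩

/-- The defining property of the uniform measure. -/
theorem uniformMeasure_cylinder (σ : List Bool) :
    uniformMeasure (cylinder σ) = (2⁻¹ : ℝ≥0∞) ^ σ.length := by
  have h : cylinder σ =
      Set.pi (Finset.range σ.length : Set ℕ) (fun i => {σ.getD i false}) := by
    ext X
    rw [mem_cylinder_iff]
    simp only [Set.mem_pi, Finset.coe_range, Set.mem_Iio, Set.mem_singleton_iff]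
    constructor
    · intro h i hi
      simpa [hi] using h ⟨i, hi⟩
    · intro h i
      simpa using h i i.2
  rw [h, uniformMeasure, MeasureTheory.Measure.infinitePi_pi _ (by simp)]
  simp

/-- A Martin-Löf test for the uniform measure, given by a uniformly c.e. sequence `S` of sets of
strings: the `i`-th open set of the test is `⟦S i⟧`. -/
def IsMartinLofTest (S : ℕ → Set (List Bool)) : Prop :=
  REPred (fun p : ℕ × List Bool => p.2 ∈ S p.1) ∧
    ∀ i, uniformMeasure (openOf (S i)) ≤ (2⁻¹ : ℝ≥0∞) ^ i

/-- The set of Martin-Löf random sequences (for the uniform measure). -/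
def MLR : Set Cantor :=
  {X | ∀ S : ℕ → Set (List Bool), IsMartinLofTest S → X ∉ ⋂ i, openOf (S i)}

/-- A Turing functional: a c.e. set of pairs of strings `(σ, τ)` such that pairs with comparable
inputs have comparable outputs. -/
structure TuringFunctional where
  pairs : Set (List Bool × List Bool)
  ce : REPred (fun p : List Bool × List Bool => p ∈ pairs)
  consistent : ∀ σ τ σ' τ' : List Bool, (σ, τ) ∈ pairs → (σ', τ') ∈ pairs →
    σ <+: σ' → τ <+: τ' ∨ τ' <+: τ

namespace TuringFunctional

/-- `Φ⁻¹(τ)`: the strings `σ` such that `(σ, τ') ∈ Φ` for some `τ' ≽ τ`. -/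
def preimage (Φ : TuringFunctional) (τ : List Bool) : Set (List Bool) :=
  {σ | ∃ τ', τ <+: τ' ∧ (σ, τ') ∈ Φ.pairs}

/-- The semi-measure induced by `Φ`: the value at `τ` is the uniform measure of `⟦Φ⁻¹(τ)⟧`. -/
noncomputable def induced (Φ : TuringFunctional) (τ : List Bool) : ℝ≥0∞ :=
  uniformMeasure (openOf (Φ.preimage τ))

/-- `τ` is an initial segment of the (finite or infinite) output `Φ^X`, the supremum of all strings
`τ'` that `Φ` assigns to an initial segment of `X`. -/
def OutputsPrefix (Φ : TuringFunctional) (X : Cantor) (τ : List Bool) : Prop :=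
  ∃ n τ', (X.restrict n, τ') ∈ Φ.pairs ∧ τ <+: τ'

/-- `Φ` as a partial map on Cantor space: `Φ(X)` is defined when the output `Φ^X` is infinite, and
is then the infinite sequence all of whose initial segments are output. -/
noncomputable def toPFun (Φ : TuringFunctional) : Cantor →. Cantor := fun X =>
  ⟨∃ Y : Cantor, ∀ n, Φ.OutputsPrefix X (Y.restrict n), fun h => h.choose⟩

theorem restrict_eq_of_prefix (X Y : Cantor) (n : ℕ) (ρ : List Bool)
    (hX : X.restrict n <+: ρ) (hY : Y.restrict n <+: ρ) : X.restrict n = Y.restrict n := by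
  have := List.prefix_of_prefix_length_le hX hY (by simp [Cantor.restrict])
  exact this.eq_of_length (by simp [Cantor.restrict])

theorem restrict_prefix (X : Cantor) {m n : ℕ} (h : m ≤ n) : X.restrict m <+: X.restrict n := by
  obtain ⟨k, rfl⟩ := Nat.exists_eq_add_of_le h
  simp [Cantor.restrict, List.range_add]

/-- The value `Φ(X)` is unique: `Y = Φ(X)` exactly when all initial segments of `Y` are output. -/
theorem mem_toPFun (Φ : TuringFunctional) (X Y : Cantor) :
    Y ∈ Φ.toPFun X ↔ ∀ n, Φ.OutputsPrefix X (Y.restrict n) := by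
  have key : ∀ Y Z : Cantor, (∀ n, Φ.OutputsPrefix X (Y.restrict n)) →
      (∀ n, Φ.OutputsPrefix X (Z.restrict n)) → Y = Z := by
    intro Y Z hY hZ
    funext i
    obtain ⟨m, τ, h1, h2⟩ := hY (i + 1)
    obtain ⟨m', τ', h1', h2'⟩ := hZ (i + 1)
    have hcmp : τ <+: τ' ∨ τ' <+: τ := by
      rcases le_total m m' with h | h
      · exact Φ.consistent _ _ _ _ h1 h1' (restrict_prefix X h)
      · exact (Φ.consistent _ _ _ _ h1' h1 (restrict_prefix X h)).symm
    have heq : Y.restrict (i + 1) = Z.restrict (i + 1) := by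
      rcases hcmp with h | h
      · exact restrict_eq_of_prefix Y Z _ τ' (h2.trans h) h2'
      · exact restrict_eq_of_prefix Y Z _ τ h2 (h2'.trans h)
    have := List.map_inj_left.1 heq i (by simp)
    exact this
  constructor
  · rintro ⟨h, rfl⟩
    exact h.choose_spec
  · intro h
    have ex : ∃ Y : Cantor, ∀ n, Φ.OutputsPrefix X (Y.restrict n) := ⟨Y, h⟩
    exact ⟨ex, key ex.choose Y ex.choose_spec h⟩

/-- `dom(Φ)`. -/
def dom (Φ : TuringFunctional) : Set Cantor := Φ.toPFun.Dom

/-- The image `Φ(A) = {Φ(X) : X ∈ A ∩ dom(Φ)}`. -/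
def image (Φ : TuringFunctional) (A : Set Cantor) : Set Cantor := Φ.toPFun.image A

end TuringFunctional

/-- A prefix-free machine: a partial computable map on strings with prefix-free domain. -/
def IsPrefixFreeMachine (M : List Bool →. List Bool) : Prop :=
  Partrec M ∧ ∀ σ τ, (M σ).Dom → (M τ).Dom → σ <+: τ → σ = τ

/-- A universal (optimal) prefix-free machine: it simulates every prefix-free machine with at most
a constant increase of program length. -/
def IsUniversalPrefixFreeMachine (U : List Bool →. List Bool) : Prop :=
  IsPrefixFreeMachine U ∧ ∀ M, IsPrefixFreeMachine M →
    ∃ c : ℕ, ∀ σ v, v ∈ M σ → ∃ τ, v ∈ U τ ∧ τ.length ≤ σ.length + c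

/-- The halting probability `∑_{U(σ)↓} 2^{-|σ|}`; the sum is at most `1` for prefix-free `U`. -/
noncomputable def haltingProbability (U : List Bool →. List Bool) : ℝ :=
  (∑' σ : {σ : List Bool // (U σ).Dom}, (2⁻¹ : ℝ≥0∞) ^ σ.1.length).toReal

/-- Chaitin's `Ω` for the machine `U`, as an infinite sequence: the binary digits of the halting
probability of `U`. -/
noncomputable def chaitinOmega (U : List Bool →. List Bool) : Cantor := fun n =>
  decide (Real.digits (haltingProbability U) 2 n = 1)

/-! Write Ω for the halting probability and let Ω_n = `N n / 2 ^ n` be computable dyadic rationals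
increasing to Ω. Identify a string of length n with the dyadic rational `binVal σ / 2 ^ n`. Let A
consist of the strings with value in [Ω_n, Ω), and B of those with value in [0, Ω - Ω_n). Both sets
are c.e. because Ω is approximated from below, and both are trees. Translation by Ω_n shows that
they have equally many strings on every level. As n grows both intervals shrink, so Ω is the only
path of A and 0^ω is the only path of B. The functional mapping each string of length n in such a
tree to 0^n induces a semi-measure that depends only on the level counts, and its domain is the set
of paths. So the two functionals induce the same semi-measure, while one maps a random sequence to
0^ω and the other is defined only at the nonrandom 0^ω (`exists_functionals`). The rest is
randomness of Ω. By `exists_gap_of_requests`, once Ω_s passes a computable threshold, a prefix-free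
machine can describe a string with no `U`-program counted so far. Some program of `U` must then
still halt, pushing Ω up by a definite amount. Applied to the cylinders of a Martin-Löf test
capturing Ω, this pushes Ω out of a cylinder containing it (`chaitinOmega_mem_MLR`). Applied to
thresholds just below a dyadic rational, it shows that Ω is not dyadic, which settles all boundary
cases. -/

/-! ### Strings as dyadic rationals -/

/-- The natural number with binary expansion `σ`, most significant bit first. -/
def binVal (σ : List Bool) : ℕ := σ.foldl (fun a b => 2 * a + b.toNat) 0

@[simp] theorem binVal_nil : binVal [] = 0 := rfl

theorem binVal_concat (σ : List Bool) (b : Bool) : binVal (σ ++ [b]) = 2 * binVal σ + b.toNat := by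
  simp [binVal]

theorem binVal_append (σ τ : List Bool) :
    binVal (σ ++ τ) = binVal σ * 2 ^ τ.length + binVal τ := by
  induction τ using List.reverseRecOn with
  | nil => simp
  | append_singleton τ b ih =>
    rw [← List.append_assoc, binVal_concat, ih, binVal_concat, List.length_append, pow_add]
    simp; ring

theorem binVal_lt (σ : List Bool) : binVal σ < 2 ^ σ.length := by
  induction σ using List.reverseRecOn with
  | nil => simp
  | append_singleton σ b ih =>
    rw [binVal_concat, List.length_append, pow_add]
    cases b <;> simp <;> omega

theorem binVal_injective_of_length {σ τ : List Bool} (hl : σ.length = τ.length)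
    (h : binVal σ = binVal τ) : σ = τ := by
  induction σ using List.reverseRecOn generalizing τ with
  | nil => exact (List.length_eq_zero_iff.1 (by simpa using hl.symm)).symm
  | append_singleton σ b ih =>
    rcases List.eq_nil_or_concat τ with rfl | ⟨τ, c, rfl⟩
    · simp at hl
    · rw [binVal_concat, List.concat_eq_append, binVal_concat] at h
      rw [List.concat_eq_append]
      have hbc : b = c := by cases b <;> cases c <;> simp_all <;> omega
      subst hbc
      rw [ih (by simpa using hl) (by omega)]

theorem exists_binVal_eq (n : ℕ) : ∀ a < 2 ^ n, ∃ σ : List Bool, σ.length = n ∧ binVal σ = a := by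
  induction n with
  | zero => intro a ha; exact ⟨[], rfl, by simp at ha; simp [ha]⟩
  | succ n ih =>
    intro a ha
    obtain ⟨σ, h1, h2⟩ := ih (a / 2) (by rw [pow_succ] at ha; omega)
    refine ⟨σ ++ [decide (a % 2 = 1)], by simp [h1], ?_⟩
    rw [binVal_concat, h2]
    rcases Nat.mod_two_eq_zero_or_one a with h | h <;> simp [h] <;> omega

theorem binVal_replicate_false (n : ℕ) : binVal (List.replicate n false) = 0 := by
  induction n with
  | zero => rfl
  | succ n ih => rw [List.replicate_succ', binVal_concat, ih]; rfl

/-- Extending a string keeps its dyadic value inside the half-open dyadic interval of the original;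
denominators are cleared. -/
theorem binVal_prefix {σ τ : List Bool} (h : σ <+: τ) :
    binVal σ * 2 ^ τ.length ≤ binVal τ * 2 ^ σ.length ∧
      binVal τ * 2 ^ σ.length < (binVal σ + 1) * 2 ^ τ.length := by
  obtain ⟨ρ, rfl⟩ := h
  have := binVal_lt ρ
  rw [binVal_append, List.length_append, pow_add]
  have h2 : 0 < 2 ^ σ.length := by positivity
  constructor <;> nlinarith

@[simp] theorem Cantor.length_restrict (X : Cantor) (n : ℕ) : (X.restrict n).length = n := by
  simp [Cantor.restrict]

theorem Cantor.restrict_succ (X : Cantor) (n : ℕ) : X.restrict (n + 1) = X.restrict n ++ [X n] := by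
  simp [Cantor.restrict, List.range_succ]

theorem Cantor.restrict_zeros (n : ℕ) : Cantor.zeros.restrict n = List.replicate n false := by
  induction n with
  | zero => rfl
  | succ n ih => rw [Cantor.restrict_succ, ih, List.replicate_succ']; rfl

theorem Cantor.ext_restrict {X Y : Cantor} (h : ∀ n, X.restrict n = Y.restrict n) : X = Y := by
  funext n
  have := h (n + 1)
  simpa [Cantor.restrict_succ, h n] using this

theorem Cantor.eq_zeros_of_binVal {X : Cantor} (h : ∀ n, binVal (X.restrict n) = 0) :
    X = Cantor.zeros := by
  refine Cantor.ext_restrict fun n => binVal_injective_of_length (by simp) ?_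
  rw [h, Cantor.restrict_zeros, binVal_replicate_false]

/-! ### Cylinders, open sets and their measure -/

theorem prefix_of_mem_cylinder {X : Cantor} {σ τ : List Bool} (hσ : X ∈ cylinder σ)
    (hτ : X ∈ cylinder τ) (h : σ.length ≤ τ.length) : σ <+: τ := by
  have h1 : X.restrict σ.length = σ := hσ
  have h2 : X.restrict τ.length = τ := hτ
  rw [← h1, ← h2]
  exact TuringFunctional.restrict_prefix X h

theorem cylinder_subset_of_prefix {σ τ : List Bool} (h : σ <+: τ) : cylinder τ ⊆ cylinder σ := by
  intro X hX
  have h2 : X.restrict τ.length = τ := hX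
  have h3 : X.restrict σ.length <+: τ := by
    have := TuringFunctional.restrict_prefix X h.length_le
    rwa [h2] at this
  exact (List.prefix_of_prefix_length_le h3 h (by simp)).eq_of_length (by simp)

theorem mem_cylinder_restrict (X : Cantor) (n : ℕ) : X ∈ cylinder (X.restrict n) := by
  change X.restrict _ = _
  simp

theorem mem_openOf {X : Cantor} {S : Set (List Bool)} :
    X ∈ openOf S ↔ ∃ n, X.restrict n ∈ S := by
  simp only [openOf, Set.mem_iUnion, exists_prop]
  constructor
  · rintro ⟨σ, h, h2⟩
    have h2 : X.restrict σ.length = σ := h2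
    exact ⟨σ.length, by rwa [h2]⟩
  · rintro ⟨n, h⟩
    exact ⟨_, h, mem_cylinder_restrict X n⟩

theorem measurableSet_cylinder (σ : List Bool) : MeasurableSet (cylinder σ) := by
  have : cylinder σ = ⋂ i : Fin σ.length, (fun X : Cantor => X i) ⁻¹' {σ[i]} := by
    ext X
    simp [mem_cylinder_iff]
  rw [this]
  exact MeasurableSet.iInter fun i => measurable_pi_apply _ (measurableSet_singleton _)

instance : MeasureTheory.IsProbabilityMeasure uniformMeasure := by
  unfold uniformMeasure
  infer_instance

/-- The measure of a disjoint union of cylinders. -/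
theorem uniformMeasure_openOf_of_pairwise {S : Set (List Bool)}
    (h : S.Pairwise fun σ τ => ¬ σ <+: τ) :
    uniformMeasure (openOf S) = ∑' σ : S, (2⁻¹ : ℝ≥0∞) ^ σ.1.length := by
  rw [openOf, MeasureTheory.measure_biUnion (Set.to_countable S) _
    fun σ _ => measurableSet_cylinder σ]
  · simp [uniformMeasure_cylinder]
  · intro σ hσ τ hτ hne
    rw [Function.onFun, Set.disjoint_left]
    intro X h1 h2
    rcases le_total σ.length τ.length with hl | hl
    · exact h hσ hτ hne (prefix_of_mem_cylinder h1 h2 hl)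
    · exact h hτ hσ hne.symm (prefix_of_mem_cylinder h2 h1 hl)

/-- Kraft's inequality. -/
theorem kraft_inequality {S : Set (List Bool)} (h : S.Pairwise fun σ τ => ¬ σ <+: τ) :
    ∑' σ : S, (2⁻¹ : ℝ≥0∞) ^ σ.1.length ≤ 1 := by
  rw [← uniformMeasure_openOf_of_pairwise h]
  exact MeasureTheory.prob_le_one

theorem uniformMeasure_openOf_level {S : Set (List Bool)} {n : ℕ} (h : ∀ σ ∈ S, σ.length = n) :
    uniformMeasure (openOf S) = S.encard * (2⁻¹ : ℝ≥0∞) ^ n := by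
  rw [uniformMeasure_openOf_of_pairwise]
  · rw [tsum_congr (g := fun _ => (2⁻¹ : ℝ≥0∞) ^ n) fun σ => by rw [h σ σ.2], ENNReal.tsum_const]
    simp
  · intro σ hσ τ hτ hne hp
    exact hne (hp.eq_of_length (by rw [h σ hσ, h τ hτ]))

theorem binVal_restrict_digits {x : ℝ} (h0 : 0 ≤ x) (h1 : x < 1) (n : ℕ) :
    binVal (Cantor.restrict (fun n => decide (Real.digits x 2 n = 1)) n) = ⌊x * 2 ^ n⌋₊ := by
  induction n with
  | zero => simp [Cantor.restrict, Nat.floor_eq_zero.2 h1]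
  | succ n ih =>
    rw [Cantor.restrict_succ, binVal_concat, ih]
    set y := x * 2 ^ n with hy
    have hy0 : 0 ≤ y := by positivity
    have h2 : ⌊x * 2 ^ (n + 1)⌋₊ / 2 = ⌊y⌋₊ := by
      have := Nat.floor_div_natCast (x * 2 ^ (n + 1)) 2
      rw [← this]; congr 1; rw [hy, pow_succ]; push_cast; ring
    have h3 : Real.digits x 2 n = Fin.ofNat 2 ⌊x * 2 ^ (n + 1)⌋₊ := by
      simp [Real.digits]
    rw [h3]
    rw [← h2]
    generalize ⌊x * 2 ^ (n + 1)⌋₊ = k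
    rcases Nat.mod_two_eq_zero_or_one k with h | h <;> simp [h, Fin.ext_iff] <;> omega

/-! ### Primitive recursive stages and enumerations -/

section

open Encodable

theorem Primrec.nat_pow : Primrec₂ ((· ^ ·) : ℕ → ℕ → ℕ) :=
  Primrec₂.unpaired'.1 Nat.Primrec.pow

theorem Primrec.sum_range {α : Type*} [Primcodable α] {g : α → ℕ → ℕ} {l : α → ℕ}
    (hg : Primrec₂ g) (hl : Primrec l) : Primrec fun a => ∑ n ∈ Finset.range (l a), g a n := by
  have : Primrec fun a => Nat.rec (motive := fun _ => ℕ) 0 (fun n s => s + g a n) (l a) := by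
    refine Primrec.nat_rec' (h := fun a p => p.2 + g a p.1) hl (Primrec.const 0) ?_
    exact Primrec.nat_add.comp (Primrec.snd.comp Primrec.snd)
      (hg.comp Primrec.fst (Primrec.fst.comp Primrec.snd))
  refine this.of_eq fun a => ?_
  induction l a with
  | zero => simp
  | succ n ih => rw [Finset.sum_range_succ, ← ih]

theorem Primrec.list_replicate {β : Type*} [Primcodable β] (b : β) :
    Primrec fun n : ℕ => List.replicate n b := by
  have : Primrec fun n : ℕ => Nat.rec (motive := fun _ => List β) [] (fun _ s => b :: s) n := by
    refine Primrec.nat_rec' (h := fun _ p => b :: p.2) Primrec.id (Primrec.const []) ?_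
    exact Primrec.list_cons.comp (Primrec.const b) (Primrec.snd.comp Primrec.snd)
  refine this.of_eq fun n => ?_
  induction n with
  | zero => rfl
  | succ n ih => rw [List.replicate_succ, ← ih]

theorem PrimrecRel.isPrefix : PrimrecRel fun σ τ : List Bool => σ <+: τ := by
  refine PrimrecRel.of_eq (r := fun σ τ : List Bool => σ = τ.take σ.length) ?_ fun σ τ =>
    List.prefix_iff_eq_take.symm
  exact Primrec.eq.comp₂ Primrec₂.left
    (Primrec.list_take.comp (Primrec.list_length.comp Primrec.fst) Primrec.snd)

/-- A semidecidable predicate given by an unbounded search. -/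
theorem REPred.of_exists {α : Type*} [Primcodable α] {p : α → ℕ → Prop} (hp : PrimrecRel p) :
    REPred fun a => ∃ n, p a n := by
  classical
  have h : Partrec fun a => Nat.rfind fun n => (Part.some (decide (p a n)) : Part Bool) :=
    Partrec.rfind (hp.decide.to_comp : Computable₂ _).partrec₂
  refine h.dom_re.of_eq fun a => ?_
  refine Nat.rfind_dom.trans ?_
  simp

theorem Partrec.of_search {α β : Type*} [Primcodable α] [Primcodable β] {g : α → ℕ → Option β}
    (hg : Primrec₂ g) : Partrec fun a => Nat.rfindOpt (g a) :=
  Partrec.rfindOpt hg.to_comp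

/-- A partial recursive function is the limit of a primitive recursive sequence of finite
approximations. -/
theorem Partrec.exists_stages {α β : Type*} [Primcodable α] [Primcodable β] {f : α →. β}
    (hf : Partrec f) : ∃ h : ℕ → α → Option β, Primrec₂ h ∧ (∀ a b, b ∈ f a ↔ ∃ s, h s a = some b) ∧
      (∀ s t a b, s ≤ t → h s a = some b → h t a = some b) ∧
      ∀ s a b, h s a = some b → encode a < s := by
  obtain ⟨c, hc⟩ := Nat.Partrec.Code.exists_code.1 hf
  refine ⟨fun s a => (Nat.Partrec.Code.evaln s c (encode a)).bind decode, ?_, ?_, ?_, ?_⟩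
  · refine Primrec.option_bind (Nat.Partrec.Code.primrec_evaln.comp
      (Primrec.pair (Primrec.pair Primrec.fst (Primrec.const c))
        (Primrec.encode.comp Primrec.snd))) ?_
    exact Primrec.decode.comp Primrec.snd
  · intro a b
    have h1 : b ∈ f a ↔ encode b ∈ c.eval (encode a) := by
      simp [hc]
    rw [h1, Nat.Partrec.Code.evaln_complete]
    constructor
    · rintro ⟨k, hk⟩
      exact ⟨k, Option.bind_eq_some_iff.2 ⟨_, hk, encodek b⟩⟩
    · rintro ⟨s, hs⟩
      obtain ⟨y, hy, hy2⟩ := Option.bind_eq_some_iff.1 hs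
      have : y ∈ c.eval (encode a) := Nat.Partrec.Code.evaln_sound hy
      simp only [hc, encodek, Part.coe_some, Part.bind_some, Part.mem_map_iff] at this
      obtain ⟨b', -, rfl⟩ := this
      rw [encodek, Option.some_inj] at hy2
      exact ⟨s, hy2 ▸ hy⟩
  · intro s t a b hst h
    obtain ⟨y, hy, hy2⟩ := Option.bind_eq_some_iff.1 h
    exact Option.bind_eq_some_iff.2 ⟨y, Nat.Partrec.Code.evaln_mono hst hy, hy2⟩
  · intro s a b h
    obtain ⟨y, hy, -⟩ := Option.bind_eq_some_iff.1 h
    exact Nat.Partrec.Code.evaln_bound hy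

/-- Every semidecidable predicate has a primitive recursive enumeration. -/
theorem REPred.exists_enumeration {α : Type*} [Primcodable α] {p : α → Prop} (hp : REPred p) :
    ∃ f : ℕ → Option α, Primrec f ∧ (∀ a, p a ↔ ∃ n, f n = some a) ∧
      ∀ n a, f n = some a → encode a ≤ n := by
  obtain ⟨h, h1, h2, -, h4⟩ := Partrec.exists_stages hp
  -- An index pairs a stage with the code of an element. Convergence by a stage bounds the code by
  -- that stage, hence by the index.
  refine ⟨fun n => (decode n.unpair.2).bind fun a => (h n.unpair.1 a).map fun _ => a, ?_, ?_, ?_⟩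
  · refine Primrec.option_bind (Primrec.decode.comp (Primrec.snd.comp Primrec.unpair)) ?_
    refine Primrec.option_map (h1.comp (Primrec.fst.comp (Primrec.unpair.comp Primrec.fst))
      Primrec.snd) ?_
    exact Primrec.snd.comp Primrec.fst
  · intro a
    have : p a ↔ ∃ s, h s a = some () := by
      rw [← h2]; simp [Part.mem_assert_iff]
    rw [this]
    constructor
    · rintro ⟨s, hs⟩
      exact ⟨Nat.pair s (encode a), by simp [hs]⟩
    · rintro ⟨n, hn⟩
      obtain ⟨a', -, ha⟩ := Option.bind_eq_some_iff.1 hn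
      obtain ⟨u, hu, rfl⟩ := Option.map_eq_some_iff.1 ha
      exact ⟨_, hu⟩
  · intro n a hn
    obtain ⟨a', ha', ha⟩ := Option.bind_eq_some_iff.1 hn
    obtain ⟨u, hu, rfl⟩ := Option.map_eq_some_iff.1 ha
    exact (h4 _ _ _ hu).le.trans (Nat.unpair_left_le n)

end

/-! ### Existence of a universal prefix-free machine -/

section

open Encodable
open Nat.Partrec (Code)

/-- Whether two strings are distinct but comparable. -/
def properlyComparable (σ τ : List Bool) : Bool :=
  decide (σ ≠ τ ∧ (σ <+: τ ∨ τ <+: σ))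

theorem primrec_properlyComparable : Primrec₂ properlyComparable := by
  have h : PrimrecRel fun σ τ : List Bool => σ ≠ τ ∧ (σ <+: τ ∨ τ <+: σ) :=
    PrimrecPred.and (PrimrecPred.not Primrec.eq)
      (PrimrecPred.or PrimrecRel.isPrefix PrimrecRel.isPrefix.swap)
  exact h.decide

/-- Whether, by stage `s`, the code `e` has converged on the number `n`, and `n` represents a string
distinct from `σ` but comparable with it. -/
def conflict (e : Code) (σ : List Bool) (s n : ℕ) : Bool :=
  ((decode n : Option (List Bool)).map (properlyComparable σ)).getD false &&
    (Code.evaln s e n).isSome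

/-- The value computed by the code `e` on `σ` by stage `s`, provided no conflict has been seen. -/
def prefixFreeStep (e : Code) (σ : List Bool) (s : ℕ) : Option (List Bool) :=
  if ∀ n < s, conflict e σ s n = false then (Code.evaln s e (encode σ)).bind decode else none

theorem primrec_prefixFreeStep :
    Primrec fun y : (Code × List Bool) × ℕ => prefixFreeStep y.1.1 y.1.2 y.2 := by
  have h1 : Primrec₂ fun (n : ℕ) (y : (Code × List Bool) × ℕ) => conflict y.1.1 y.1.2 y.2 n := by
    refine Primrec.and.comp (Primrec.option_getD.comp (Primrec.option_map
      (Primrec.decode.comp Primrec.fst) ?_) (Primrec.const false)) (Primrec.option_isSome.comp ?_)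
    · exact primrec_properlyComparable.comp
        (Primrec.snd.comp (Primrec.fst.comp (Primrec.snd.comp Primrec.fst))) Primrec.snd
    · exact Code.primrec_evaln.comp (Primrec.pair (Primrec.pair (Primrec.snd.comp Primrec.snd)
        (Primrec.fst.comp (Primrec.fst.comp Primrec.snd))) Primrec.fst)
  have h2 : PrimrecRel fun (n : ℕ) (y : (Code × List Bool) × ℕ) =>
      conflict y.1.1 y.1.2 y.2 n = false := Primrec.eq.comp₂ h1 (Primrec₂.const false)
  have h3 : PrimrecPred fun y : (Code × List Bool) × ℕ =>
      ∀ n < y.2, conflict y.1.1 y.1.2 y.2 n = false :=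
    (h2.forall_mem_list.comp (Primrec.list_range.comp Primrec.snd) Primrec.id).of_eq
      fun y => by simp
  refine Primrec.ite h3 ?_ (Primrec.const none)
  refine Primrec.option_bind (Code.primrec_evaln.comp (Primrec.pair (Primrec.pair Primrec.snd
    (Primrec.fst.comp Primrec.fst)) (Primrec.encode.comp (Primrec.snd.comp Primrec.fst)))) ?_
  exact Primrec.decode.comp Primrec.snd

/-- For an arbitrary code, the string released at the later stage would have seen the other,
comparable one already converged, which blocks it. -/
theorem eq_of_prefixFreeStep {e : Code} {σ τ v w : List Bool} {s t : ℕ}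
    (hσ : prefixFreeStep e σ s = some v) (hτ : prefixFreeStep e τ t = some w)
    (h : σ <+: τ ∨ τ <+: σ) : σ = τ := by
  wlog hst : s ≤ t generalizing σ τ s t v w
  · exact (this hτ hσ h.symm (by omega)).symm
  by_contra hne
  unfold prefixFreeStep at hσ hτ
  split_ifs at hσ hτ with h1 h2
  obtain ⟨y, hy, -⟩ := Option.bind_eq_some_iff.1 hσ
  have hy2 := Code.evaln_mono hst hy
  have := h2 (encode σ) (Code.evaln_bound hy2)
  rw [conflict, Option.mem_def.1 hy2] at this
  simp [properlyComparable] at this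
  exact (this (Ne.symm hne)).elim (fun h1 h2 => h.elim h2 h1)

/-- A machine whose domain is already prefix-free never produces a conflict, so the filter loses
nothing. -/
theorem exists_prefixFreeStep {M : List Bool →. List Bool}
    (hM : ∀ σ τ, (M σ).Dom → (M τ).Dom → σ <+: τ → σ = τ) {e : Code}
    (he : e.eval = fun n => Part.bind (decode (α := List Bool) n : Part (List Bool)) fun a => (M a).map encode)
    {σ v : List Bool} (hv : v ∈ M σ) : ∃ s, prefixFreeStep e σ s = some v := by
  have h1 : encode v ∈ e.eval (encode σ) := by simp [he, hv]
  obtain ⟨s, hs⟩ := Code.evaln_complete.1 h1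
  refine ⟨s, ?_⟩
  rw [prefixFreeStep, if_pos, Option.mem_def.1 hs, Option.bind_some, encodek]
  intro n hn
  by_contra hc
  rw [Bool.not_eq_false, conflict, Bool.and_eq_true] at hc
  obtain ⟨hc1, hc2⟩ := hc
  obtain ⟨y, hy⟩ := Option.isSome_iff_exists.1 hc2
  cases hd : (decode n : Option (List Bool)) with
  | none => simp [hd] at hc1
  | some τ =>
    have hy2 := Code.evaln_sound (Option.mem_def.2 hy)
    simp [he, hd] at hy2
    obtain ⟨w, hw, -⟩ := hy2
    simp [hd, properlyComparable] at hc1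
    have hσd : (M σ).Dom := Part.dom_iff_mem.2 ⟨v, hv⟩
    have hτd : (M τ).Dom := Part.dom_iff_mem.2 ⟨w, hw⟩
    exact hc1.1 (hc1.2.elim (hM _ _ hσd hτd) fun h => (hM _ _ hτd hσd h).symm)

/-- The computation of the universal machine: a program is `1^e 0 σ`, where `e` is a code. -/
def universalStep (ρ : List Bool) (s : ℕ) : Option (List Bool) :=
  if (ρ.takeWhile id).length < ρ.length then
    prefixFreeStep (Denumerable.ofNat Code (ρ.takeWhile id).length)
      (ρ.drop ((ρ.takeWhile id).length + 1)) s
  else none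

theorem primrec_universalStep : Primrec₂ universalStep := by
  have h : Primrec fun y : List Bool × ℕ => (y.1.takeWhile id).length :=
    Primrec.list_length.comp ((Primrec.list_takeWhile Primrec.id).comp Primrec.fst)
  refine Primrec.ite (Primrec.nat_lt.comp h (Primrec.list_length.comp Primrec.fst)) ?_
    (Primrec.const none)
  exact primrec_prefixFreeStep.comp (Primrec.pair (Primrec.pair ((Primrec.ofNat Code).comp h)
    (Primrec.list_drop.comp (Primrec.succ.comp h) Primrec.fst)) Primrec.snd)

theorem takeWhile_id_append (σ τ : List Bool) (h : (σ.takeWhile id).length < σ.length) :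
    (σ ++ τ).takeWhile id = σ.takeWhile id := by
  rw [List.takeWhile_append, if_neg h.ne]

theorem universalStep_program (e : ℕ) (σ : List Bool) (s : ℕ) :
    universalStep (List.replicate e true ++ false :: σ) s =
      prefixFreeStep (Denumerable.ofNat Code e) σ s := by
  have : (List.replicate e true ++ false :: σ).takeWhile id = List.replicate e true := by
    rw [List.takeWhile_append]; simp
  rw [universalStep, this, if_pos (by simp)]
  congr 1
  · simp
  · simp [List.drop_append]

theorem exists_isUniversalPrefixFreeMachine :
    ∃ U : List Bool →. List Bool, IsUniversalPrefixFreeMachine U := by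
  refine ⟨fun ρ => Nat.rfindOpt (universalStep ρ),
    ⟨Partrec.of_search primrec_universalStep, ?_⟩, ?_⟩
  · rintro σ _ h1 h2 ⟨ρ, rfl⟩
    obtain ⟨s, v, hs⟩ := Nat.rfindOpt_dom.1 h1
    obtain ⟨t, w, ht⟩ := Nat.rfindOpt_dom.1 h2
    rw [Option.mem_def, universalStep] at hs ht
    split_ifs at hs ht with hl hl2
    rw [takeWhile_id_append σ ρ hl] at ht
    have := eq_of_prefixFreeStep hs ht (Or.inl (List.IsPrefix.drop (List.prefix_append _ _) _))
    have hlen := congrArg List.length this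
    simp only [List.length_drop, List.length_append] at hlen
    rw [List.length_eq_zero_iff.1 (show ρ.length = 0 by omega), List.append_nil]
  · intro M hM
    obtain ⟨e, he⟩ := Code.exists_code.1 hM.1
    refine ⟨encode e + 1, fun σ v hv => ?_⟩
    obtain ⟨s, hs⟩ := exists_prefixFreeStep hM.2 he hv
    refine ⟨List.replicate (encode e) true ++ false :: σ, ?_, by simp; omega⟩
    rw [← Denumerable.ofNat_encode e, ← universalStep_program] at hs
    have hdom : (Nat.rfindOpt
        (universalStep (List.replicate (encode e) true ++ false :: σ))).Dom :=
      Nat.rfindOpt_dom.2 ⟨s, v, by simpa using hs⟩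
    obtain ⟨w, hw⟩ := Part.dom_iff_mem.1 hdom
    obtain ⟨t, ht⟩ := Nat.rfindOpt_spec hw
    rw [universalStep_program] at ht hs
    simp only [Denumerable.ofNat_encode, Option.mem_def] at ht hs
    -- The search may succeed at a stage other than `s`, but both values come from the same
    -- computation of `e`.
    have : v = w := by
      unfold prefixFreeStep at ht hs
      split_ifs at ht hs
      obtain ⟨y, hy, hy2⟩ := Option.bind_eq_some_iff.1 hs
      obtain ⟨z, hz, hz2⟩ := Option.bind_eq_some_iff.1 ht
      have := Part.mem_unique (Code.evaln_sound hy) (Code.evaln_sound hz)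
      simpa [this, hz2] using hy2.symm
    exact this ▸ hw

end

/-! ### Approximating the halting probability from below -/

section

open Encodable Filter Topology

/-- Turns a sum over the finitely many programs halted by stage `s` into a sum over codes below `s`,
which is visibly primitive recursive. `decode₂` counts each string once. -/
theorem sum_range_decode₂ {s : ℕ} {h : List Bool → Option (List Bool)} {F : Finset (List Bool)}
    (hF : ∀ σ, σ ∈ F ↔ (h σ).isSome) (hs : ∀ σ ∈ F, encode σ < s)
    (ψ : List Bool → List Bool → ℕ) :
    ∑ n ∈ Finset.range s, ((decode₂ (List Bool) n).bind fun σ => (h σ).map (ψ σ)).getD 0 =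
      ∑ σ ∈ F, ((h σ).map (ψ σ)).getD 0 := by
  have h1 : F.image encode ⊆ Finset.range s := by
    intro n hn
    obtain ⟨σ, hσ, rfl⟩ := Finset.mem_image.1 hn
    exact Finset.mem_range.2 (hs σ hσ)
  rw [← Finset.sum_subset h1, Finset.sum_image fun σ _ τ _ h => encode_injective h]
  · simp
  · intro n _ hn
    cases hd : decode₂ (List Bool) n with
    | none => rfl
    | some σ =>
      have hσ : encode σ = n := mem_decode₂.1 hd
      have : σ ∉ F := fun h => hn (Finset.mem_image.2 ⟨σ, h, hσ⟩)
      rw [hF, Option.not_isSome_iff_eq_none] at this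
      simp [this]

theorem hasSum_haltingProbability {U : List Bool →. List Bool} (hU : IsPrefixFreeMachine U) :
    HasSum ({σ | (U σ).Dom}.indicator fun σ => ((2 : ℝ) ^ σ.length)⁻¹) (haltingProbability U) := by
  have h1 : ∑' σ : {σ : List Bool // (U σ).Dom}, (2⁻¹ : ℝ≥0∞) ^ σ.1.length ≤ 1 :=
    kraft_inequality (S := {σ | (U σ).Dom}) fun σ hσ τ hτ hne hp => hne (hU.2 σ τ hσ hτ hp)
  have h2 := (ENNReal.summable_toReal (ne_top_of_le_ne_top ENNReal.one_ne_top h1)).hasSum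
  rw [← ENNReal.tsum_toReal_eq (fun _ => by finiteness)] at h2
  refine hasSum_subtype_iff_indicator.1 ?_
  simp only [ENNReal.toReal_pow, ENNReal.toReal_inv, ENNReal.toReal_ofNat, inv_pow] at h2
  exact h2

theorem haltingProbability_nonneg (U : List Bool →. List Bool) : 0 ≤ haltingProbability U :=
  ENNReal.toReal_nonneg

theorem haltingProbability_le_one {U : List Bool →. List Bool} (hU : IsPrefixFreeMachine U) :
    haltingProbability U ≤ 1 := by
  refine ENNReal.toReal_le_of_le_ofReal zero_le_one ?_
  rw [ENNReal.ofReal_one]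
  exact kraft_inequality (S := {σ | (U σ).Dom}) fun σ hσ τ hτ hne hp => hne (hU.2 σ τ hσ hτ hp)

/-- Computable dyadic approximations from below to the halting probability, together with strings
having no short program that has not yet been counted. -/
theorem exists_haltingProbability_approx {U : List Bool →. List Bool}
    (hU : IsPrefixFreeMachine U) : ∃ (N : ℕ → ℕ) (x : ℕ → List Bool), Primrec N ∧ Primrec x ∧
      Monotone (fun s => (N s : ℝ) / 2 ^ s) ∧
      Tendsto (fun s => (N s : ℝ) / 2 ^ s) atTop (𝓝 (haltingProbability U)) ∧
      ∀ s τ, x s ∈ U τ → (N s : ℝ) / 2 ^ s + (2 ^ τ.length)⁻¹ ≤ haltingProbability U := by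
  obtain ⟨h, h1, h2, h3, h4⟩ := Partrec.exists_stages hU.1
  have hfin (s : ℕ) : {σ | (h s σ).isSome}.Finite := by
    refine Set.Finite.of_finite_image (f := encode) ((Set.finite_lt_nat s).subset ?_)
      encode_injective.injOn
    rintro _ ⟨σ, hσ, rfl⟩
    obtain ⟨v, hv⟩ := Option.isSome_iff_exists.1 hσ
    exact h4 _ _ _ hv
  set F : ℕ → Finset (List Bool) := fun s => (hfin s).toFinset with hFdef
  have hF (s σ) : σ ∈ F s ↔ (h s σ).isSome := by simp [hFdef]
  have hFs (s) : ∀ σ ∈ F s, encode σ < s := by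
    intro σ hσ
    obtain ⟨v, hv⟩ := Option.isSome_iff_exists.1 ((hF s σ).1 hσ)
    exact h4 _ _ _ hv
  have hFm : Monotone F := by
    intro s t hst σ hσ
    obtain ⟨v, hv⟩ := Option.isSome_iff_exists.1 ((hF s σ).1 hσ)
    exact (hF t σ).2 (Option.isSome_iff_exists.2 ⟨v, h3 _ _ _ _ hst hv⟩)
  have hFd (σ) : (U σ).Dom ↔ ∃ s, σ ∈ F s := by
    simp only [hF, Part.dom_iff_mem, h2, Option.isSome_iff_exists]
    exact exists_comm
  set N : ℕ → ℕ := fun s => ∑ n ∈ Finset.range s,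
    ((decode₂ (List Bool) n).bind fun σ => (h s σ).map fun _ => 2 ^ (s - σ.length)).getD 0
  set B : ℕ → ℕ := fun s => ∑ n ∈ Finset.range s,
    ((decode₂ (List Bool) n).bind fun σ => (h s σ).map List.length).getD 0
  have hprim {ψ : (ℕ × List Bool) × List Bool → ℕ} (hψ : Primrec ψ) :
      Primrec fun s => ∑ n ∈ Finset.range s, ((decode₂ (List Bool) n).bind
        fun σ => (h s σ).map fun v => ψ ((s, σ), v)).getD 0 := by
    refine Primrec.sum_range (g := fun s n => ((decode₂ (List Bool) n).bind
        fun σ => (h s σ).map fun v => ψ ((s, σ), v)).getD 0) ?_ Primrec.id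
    refine Primrec.option_getD.comp (Primrec.option_bind (Primrec.decode₂.comp Primrec.snd) ?_)
      (Primrec.const 0)
    refine Primrec.option_map (h1.comp (Primrec.fst.comp Primrec.fst) Primrec.snd) ?_
    exact hψ.comp (Primrec.pair (Primrec.pair (Primrec.fst.comp (Primrec.fst.comp Primrec.fst))
      (Primrec.snd.comp Primrec.fst)) Primrec.snd)
  have hN : Primrec N := hprim (ψ := fun y => 2 ^ (y.1.1 - y.1.2.length))
    (Primrec.nat_pow.comp (Primrec.const 2) (Primrec.nat_sub.comp (Primrec.fst.comp Primrec.fst)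
      (Primrec.list_length.comp (Primrec.snd.comp Primrec.fst))))
  have hB : Primrec B := hprim (ψ := fun y => y.2.length) (Primrec.list_length.comp Primrec.snd)
  have hNF (s : ℕ) : (N s : ℝ) / 2 ^ s = ∑ σ ∈ F s, ((2 : ℝ) ^ σ.length)⁻¹ := by
    have : N s = ∑ σ ∈ F s, 2 ^ (s - σ.length) := by
      refine (sum_range_decode₂ (hF s) (hFs s) _).trans (Finset.sum_congr rfl fun σ hσ => ?_)
      obtain ⟨v, hv⟩ := Option.isSome_iff_exists.1 ((hF s σ).1 hσ)
      simp [hv]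
    rw [this, Nat.cast_sum, Finset.sum_div]
    refine Finset.sum_congr rfl fun σ hσ => ?_
    -- The length is at most the code, so the exponent `s - σ.length` is not truncated.
    have hle : σ.length ≤ s := (length_le_encode σ).trans (hFs s σ hσ).le
    obtain ⟨d, rfl⟩ := Nat.exists_eq_add_of_le hle
    rw [Nat.add_sub_cancel_left, pow_add]
    push_cast
    field_simp
  have hsum := hasSum_haltingProbability hU
  set r : List Bool → ℝ := {σ | (U σ).Dom}.indicator fun σ => ((2 : ℝ) ^ σ.length)⁻¹ with hr
  have hr0 (σ) : 0 ≤ r σ := Set.indicator_nonneg (fun _ _ => by positivity) σ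
  have hrd (σ) (hσ : (U σ).Dom) : r σ = ((2 : ℝ) ^ σ.length)⁻¹ :=
    Set.indicator_of_mem (show σ ∈ {σ | (U σ).Dom} from hσ) _
  have hNr (s : ℕ) : (N s : ℝ) / 2 ^ s = ∑ σ ∈ F s, r σ := by
    rw [hNF]
    exact Finset.sum_congr rfl fun σ hσ => (hrd σ ((hFd σ).2 ⟨s, hσ⟩)).symm
  have hmono : Monotone fun s => (N s : ℝ) / 2 ^ s := by
    intro s t hst
    simp only [hNr]
    exact Finset.sum_le_sum_of_subset_of_nonneg (hFm hst) fun σ _ _ => hr0 σ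
  -- `B s` is the total length of the outputs seen by stage `s`, so this string is longer than each
  -- of them and any program for it is still uncounted.
  refine ⟨N, fun s => List.replicate (B s + 1) true, hN,
    (Primrec.list_replicate true).comp (Primrec.succ.comp hB), hmono, ?_, ?_⟩
  · refine tendsto_atTop_isLUB hmono ⟨?_, fun y hy => ?_⟩
    · rintro _ ⟨s, rfl⟩
      simp only [hNr]
      exact sum_le_hasSum _ (fun σ _ => hr0 σ) hsum
    · refine (isLUB_hasSum hr0 hsum).2 ?_
      rintro _ ⟨T, rfl⟩
      have : ∀ᶠ s in atTop, ∀ σ ∈ T, (U σ).Dom → σ ∈ F s := by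
        refine (Finset.eventually_all T).2 fun σ _ => ?_
        by_cases hσ : (U σ).Dom
        · obtain ⟨s, hs⟩ := (hFd σ).1 hσ
          filter_upwards [eventually_ge_atTop s] with t ht _ using hFm ht hs
        · exact Eventually.of_forall fun s h => absurd h hσ
      obtain ⟨s, hs⟩ := this.exists
      refine le_trans ?_ ((hNr s).symm.le.trans (hy ⟨s, rfl⟩))
      classical
      beta_reduce
      rw [← Finset.sum_filter_add_sum_filter_not T fun σ => (U σ).Dom]
      rw [Finset.sum_eq_zero (s := T.filter fun σ => ¬ (U σ).Dom), add_zero]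
      · refine Finset.sum_le_sum_of_subset_of_nonneg (fun σ hσ => ?_) fun σ _ _ => hr0 σ
        exact hs σ (Finset.mem_filter.1 hσ).1 (Finset.mem_filter.1 hσ).2
      · intro σ hσ
        exact Set.indicator_of_notMem (s := {σ | (U σ).Dom}) (Finset.mem_filter.1 hσ).2 _
  · intro s τ hτ
    have hτd : (U τ).Dom := Part.dom_iff_mem.2 ⟨_, hτ⟩
    have hτF : τ ∉ F s := by
      intro hmem
      obtain ⟨v, hv⟩ := Option.isSome_iff_exists.1 ((hF s τ).1 hmem)
      have hvx := Part.mem_unique ((h2 τ v).2 ⟨s, hv⟩) hτ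
      have hB1 : B s = ∑ σ ∈ F s, ((h s σ).map List.length).getD 0 :=
        sum_range_decode₂ (hF s) (hFs s) fun _ => List.length
      have hB2 := Finset.single_le_sum (f := fun σ => ((h s σ).map List.length).getD 0)
        (fun _ _ => Nat.zero_le _) hmem
      simp only [hv, hvx] at hB2
      simp at hB2
      omega
    have := sum_le_hasSum (insert τ (F s)) (fun σ _ => hr0 σ) hsum
    rw [Finset.sum_insert hτF, hrd τ hτd, ← hNr] at this
    linarith

/-! ### Effective Kraft coding -/

theorem primrec_binVal : Primrec binVal := by
  refine Primrec.list_foldl (h := fun _ (p : ℕ × Bool) => 2 * p.1 + p.2.toNat) Primrec.id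
    (Primrec.const 0) ?_
  exact Primrec.nat_add.comp (Primrec.nat_mul.comp (Primrec.const 2)
    (Primrec.fst.comp Primrec.snd)) ((Primrec.dom_bool Bool.toNat).comp
      (Primrec.snd.comp Primrec.snd))

/-- The numerator and the exponent of the denominator of `∑ j < k, 2 ^ (-m j)`. -/
def kraftState (m : ℕ → ℕ) (k : ℕ) : ℕ × ℕ :=
  Nat.rec (0, 0) (fun j p => (p.1 * 2 ^ m j + 2 ^ p.2, p.2 + m j)) k

theorem kraftState_eq (m : ℕ → ℕ) (k : ℕ) :
    ((kraftState m k).1 : ℝ) =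
      (∑ j ∈ Finset.range k, ((2 : ℝ) ^ m j)⁻¹) * 2 ^ (kraftState m k).2 := by
  induction k with
  | zero => simp [kraftState]
  | succ k ih =>
    have h1 : kraftState m (k + 1) =
      ((kraftState m k).1 * 2 ^ m k + 2 ^ (kraftState m k).2, (kraftState m k).2 + m k) := rfl
    rw [h1, Finset.sum_range_succ]
    push_cast
    rw [ih, pow_add]
    field_simp

theorem primrec_kraftState {m : ℕ → ℕ} (hm : Primrec m) : Primrec (kraftState m) := by
  have h1 : Primrec fun y : ℕ × (ℕ × (ℕ × ℕ)) => m y.2.1 :=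
    hm.comp (Primrec.fst.comp Primrec.snd)
  have h2 : Primrec fun y : ℕ × (ℕ × (ℕ × ℕ)) => y.2.2.2 :=
    Primrec.snd.comp (Primrec.snd.comp Primrec.snd)
  refine Primrec.nat_rec' (h := fun _ (p : ℕ × (ℕ × ℕ)) =>
    (p.2.1 * 2 ^ m p.1 + 2 ^ p.2.2, p.2.2 + m p.1)) Primrec.id (Primrec.const (0, 0)) ?_
  exact Primrec.pair (Primrec.nat_add.comp (Primrec.nat_mul.comp
    (Primrec.fst.comp (Primrec.snd.comp Primrec.snd))
    (Primrec.nat_pow.comp (Primrec.const 2) h1)) (Primrec.nat_pow.comp (Primrec.const 2) h2))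
    (Primrec.nat_add.comp h2 h1)

/-- An effective form of the converse of Kraft's inequality, up to one extra bit: there is a
computable prefix-free sequence of strings of lengths `m k + 1`, here given by their values. -/
theorem exists_kraft_code {m : ℕ → ℕ} (hm : Primrec m)
    (hsum : ∑' k, (2⁻¹ : ℝ≥0∞) ^ m k ≤ 1) :
    ∃ pos : ℕ → ℕ, Primrec pos ∧ (∀ k, pos k < 2 ^ (m k + 1)) ∧
      ∀ j k (σ τ : List Bool), σ.length = m j + 1 → binVal σ = pos j → τ.length = m k + 1 →
        binVal τ = pos k → σ <+: τ → j = k := by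
  set p : ℕ → ℝ := fun k => ∑ j ∈ Finset.range k, ((2 : ℝ) ^ m j)⁻¹ with hp
  have hp0 (k) : 0 ≤ p k := Finset.sum_nonneg fun _ _ => by positivity
  have hp1 (k) : p k ≤ 1 := by
    have h1 := (ENNReal.sum_le_tsum (Finset.range k)).trans hsum
    have h2 := ENNReal.toReal_mono ENNReal.one_ne_top h1
    rw [ENNReal.toReal_sum (fun _ _ => by finiteness)] at h2
    simpa [hp] using h2
  have hps (k) : p (k + 1) = p k + ((2 : ℝ) ^ m k)⁻¹ := Finset.sum_range_succ _ _
  have hpm : Monotone p := monotone_nat_of_le_succ fun k => by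
    rw [hps]; linarith [show (0 : ℝ) < (2 ^ m k)⁻¹ by positivity]
  -- The interval from `p k` to `p (k + 1)` has length `2 ^ (-m k)`, twice the mesh `2 ^ (-(m k +
  -- 1))`. The first grid point strictly beyond `p k` therefore starts a full cell inside it, and
  -- cells for different `k` are disjoint.
  set pos : ℕ → ℕ := fun k =>
    (kraftState m k).1 * 2 ^ (m k + 1) / 2 ^ (kraftState m k).2 + 1 with hpos
  have hposf (k) : pos k = ⌊p k * 2 ^ (m k + 1)⌋₊ + 1 := by
    have h1 := Nat.floor_div_eq_div (K := ℝ) ((kraftState m k).1 * 2 ^ (m k + 1))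
      (2 ^ (kraftState m k).2)
    rw [hpos]
    simp only
    rw [← h1]
    push_cast
    rw [kraftState_eq]
    congr 2
    rw [mul_right_comm, mul_div_cancel_right₀ _ (by positivity)]
  have hlow (k) : p k * 2 ^ (m k + 1) < pos k := by
    rw [hposf]; push_cast; exact Nat.lt_floor_add_one _
  have hup (k) : (pos k : ℝ) + 1 ≤ p (k + 1) * 2 ^ (m k + 1) := by
    rw [hposf, hps, add_mul]; push_cast
    have := Nat.floor_le (show 0 ≤ p k * 2 ^ (m k + 1) by have := hp0 k; positivity)
    have h2 : ((2 : ℝ) ^ m k)⁻¹ * 2 ^ (m k + 1) = 2 := by rw [pow_succ]; field_simp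
    linarith
  refine ⟨pos, ?_, ?_, ?_⟩
  · have h1 := primrec_kraftState hm
    exact Primrec.succ.comp (Primrec.nat_div.comp (Primrec.nat_mul.comp (Primrec.fst.comp h1)
      (Primrec.nat_pow.comp (Primrec.const 2) (Primrec.succ.comp hm)))
      (Primrec.nat_pow.comp (Primrec.const 2) (Primrec.snd.comp h1)))
  · intro k
    have h1 : (pos k : ℝ) + 1 ≤ 2 ^ (m k + 1) :=
      (hup k).trans (mul_le_of_le_one_left (by positivity) (hp1 _))
    have : pos k + 1 ≤ 2 ^ (m k + 1) := by exact_mod_cast h1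
    omega
  · intro j k σ τ hσ hσp hτ hτp h
    obtain ⟨h1, h2⟩ := binVal_prefix h
    rw [hσp, hτp, hσ, hτ] at h1 h2
    have h1' : (pos j : ℝ) * 2 ^ (m k + 1) ≤ pos k * 2 ^ (m j + 1) := by exact_mod_cast h1
    have h2' : (pos k : ℝ) * 2 ^ (m j + 1) < (pos j + 1) * 2 ^ (m k + 1) := by exact_mod_cast h2
    have hP : (0 : ℝ) < 2 ^ (m j + 1) := by positivity
    have hQ : (0 : ℝ) < 2 ^ (m k + 1) := by positivity
    rcases lt_trichotomy j k with hjk | hjk | hjk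
    · have h3 := (hup j).trans (mul_le_mul_of_nonneg_right (hpm hjk : p (j + 1) ≤ p k) hP.le)
      have h4 := mul_le_mul_of_nonneg_right h3 hQ.le
      have h5 := mul_lt_mul_of_pos_right (hlow k) hP
      exfalso; linarith
    · exact hjk
    · have h3 := (hup k).trans (mul_le_mul_of_nonneg_right (hpm hjk : p (k + 1) ≤ p j) hQ.le)
      have h4 := mul_le_mul_of_nonneg_right h3 hP.le
      have h5 := mul_lt_mul_of_pos_right (hlow j) hQ
      exfalso; nlinarith

/-! ### Forcing the halting probability upwards -/

/-- The halting probability of a universal machine cannot be approximated from below too well: if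
it exceeds computably given rationals, then it does so by an amount proportional to weights with a
bounded sum. -/
theorem exists_gap_of_requests {U : List Bool →. List Bool} (hU : IsUniversalPrefixFreeMachine U)
    {a b m : ℕ → ℕ} (ha : Primrec a) (hb : Primrec b) (hm : Primrec m)
    (hsum : ∑' k, (2⁻¹ : ℝ≥0∞) ^ m k ≤ 1) :
    ∃ c : ℕ, ∀ k, ((a k : ℝ) - 1) / 2 ^ b k < haltingProbability U →
      ((a k : ℝ) - 1) / 2 ^ b k + (2 ^ (m k + c))⁻¹ ≤ haltingProbability U := by
  obtain ⟨N, x, hN, hx, -, hlim, hxU⟩ := exists_haltingProbability_approx hU.1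
  obtain ⟨pos, hpos, hpos1, hpos2⟩ := exists_kraft_code hm hsum
  -- The search index `n` pairs a request `k` with a stage `s`: `σ` must be the code word of `k`,
  -- and `N s / 2 ^ s` must exceed `(a k - 1) / 2 ^ b k`, written without subtraction. The machine
  -- then outputs `x s`.
  set P : List Bool → ℕ → Prop := fun σ n =>
    (σ.length = m n.unpair.1 + 1 ∧ binVal σ = pos n.unpair.1) ∧
      a n.unpair.1 * 2 ^ n.unpair.2 < N n.unpair.2 * 2 ^ b n.unpair.1 + 2 ^ n.unpair.2 with hP
  have hPprim : PrimrecRel P := by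
    have hk : Primrec fun y : List Bool × ℕ => y.2.unpair.1 :=
      Primrec.fst.comp (Primrec.unpair.comp Primrec.snd)
    have hs : Primrec fun y : List Bool × ℕ => y.2.unpair.2 :=
      Primrec.snd.comp (Primrec.unpair.comp Primrec.snd)
    have h2s := Primrec.nat_pow.comp (Primrec.const 2) hs
    refine PrimrecPred.and (PrimrecPred.and ?_ ?_) ?_
    · exact Primrec.eq.comp (Primrec.list_length.comp Primrec.fst)
        (Primrec.succ.comp (hm.comp hk))
    · exact Primrec.eq.comp (primrec_binVal.comp Primrec.fst) (hpos.comp hk)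
    · exact Primrec.nat_lt.comp (Primrec.nat_mul.comp (ha.comp hk) h2s)
        (Primrec.nat_add.comp (Primrec.nat_mul.comp (hN.comp hs)
          (Primrec.nat_pow.comp (Primrec.const 2) (hb.comp hk))) h2s)
  classical
  set step : List Bool → ℕ → Option (List Bool) := fun σ n =>
    if P σ n then some (x n.unpair.2) else none with hstep
  have hstep_prim : Primrec₂ step :=
    Primrec.ite hPprim (Primrec.option_some.comp (hx.comp
      (Primrec.snd.comp (Primrec.unpair.comp Primrec.snd)))) (Primrec.const none)
  have hstep_some {σ n v} (h : v ∈ step σ n) : P σ n ∧ x n.unpair.2 = v := by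
    rw [hstep] at h
    simpa [ite_eq_iff] using h
  have hM : IsPrefixFreeMachine fun σ => Nat.rfindOpt (step σ) := by
    refine ⟨Partrec.of_search hstep_prim, fun σ τ hσ hτ h => ?_⟩
    obtain ⟨i, v, hv⟩ := Nat.rfindOpt_dom.1 hσ
    obtain ⟨j, w, hw⟩ := Nat.rfindOpt_dom.1 hτ
    obtain ⟨⟨⟨h1, h2⟩, -⟩, -⟩ := hstep_some hv
    obtain ⟨⟨⟨h3, h4⟩, -⟩, -⟩ := hstep_some hw
    have hij := hpos2 _ _ σ τ h1 h2 h3 h4 h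
    exact h.eq_of_length (by rw [h1, h3, hij])
  obtain ⟨c, hc⟩ := hU.2 _ hM
  have hlt (k s : ℕ) : a k * 2 ^ s < N s * 2 ^ b k + 2 ^ s ↔
      ((a k : ℝ) - 1) / 2 ^ b k < N s / 2 ^ s := by
    rw [div_lt_div_iff₀ (by positivity) (by positivity), ← Nat.cast_lt (α := ℝ)]
    push_cast
    constructor <;> intro h <;> linarith
  -- The extra 1 pays for code words having length `m k + 1`.
  refine ⟨c + 1, fun k hk => ?_⟩
  obtain ⟨s, hs⟩ := (hlim.eventually (lt_mem_nhds hk)).exists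
  obtain ⟨σ, hσ1, hσ2⟩ := exists_binVal_eq (m k + 1) (pos k) (hpos1 k)
  have hdom : (Nat.rfindOpt (step σ)).Dom := by
    refine Nat.rfindOpt_dom.2 ⟨Nat.pair k s, x s, ?_⟩
    have : P σ (Nat.pair k s) := by
      simp only [hP, Nat.unpair_pair]
      exact ⟨⟨hσ1, hσ2⟩, (hlt k s).2 hs⟩
    simp [hstep, this]
  obtain ⟨v, hv⟩ := Part.dom_iff_mem.1 hdom
  obtain ⟨n, hn⟩ := Nat.rfindOpt_spec hv
  obtain ⟨⟨⟨h1, h2⟩, h3⟩, rfl⟩ := hstep_some hn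
  -- The stage found by the search is unknown, but the code word determines the request.
  have hnk : n.unpair.1 = k := hpos2 _ _ σ σ h1 h2 hσ1 hσ2 List.prefix_rfl
  rw [hnk] at h3
  obtain ⟨τ, hτ, hτl⟩ := hc σ _ hv
  have h4 := hxU _ _ hτ
  have h5 := (hlt k _).1 h3
  have h6 : ((2 : ℝ) ^ (m k + (c + 1)))⁻¹ ≤ (2 ^ τ.length)⁻¹ := by
    apply inv_anti₀ (by positivity)
    apply pow_le_pow_right₀ (by norm_num)
    omega
  linarith

/-- If Ω were dyadic, requests with thresholds `2 ^ (-(b + 2 * k))` below it would force gaps of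
order `2 ^ (-k)`, too large once `k` exceeds the machine constant. -/
theorem haltingProbability_ne_dyadic {U : List Bool →. List Bool}
    (hU : IsUniversalPrefixFreeMachine U) (a b : ℕ) : haltingProbability U ≠ a / 2 ^ b := by
  intro h
  have h2k : Primrec fun k : ℕ => 2 * k := Primrec.nat_mul.comp (Primrec.const 2) Primrec.id
  obtain ⟨c, hc⟩ := exists_gap_of_requests hU (a := fun k => a * 2 ^ (2 * k))
    (b := fun k => b + 2 * k) (m := fun k => k + 1)
    (Primrec.nat_mul.comp (Primrec.const a) (Primrec.nat_pow.comp (Primrec.const 2) h2k))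
    (Primrec.nat_add.comp (Primrec.const b) h2k) Primrec.succ
    (by rw [ENNReal.tsum_geometric_add_one, ENNReal.one_sub_inv_two, inv_inv,
          ENNReal.inv_mul_cancel (by simp) (by simp)])
  have h1 := hc (c + 2)
  have h3 : (((a * 2 ^ (2 * (c + 2)) : ℕ) : ℝ) - 1) / 2 ^ (b + 2 * (c + 2)) =
      haltingProbability U - (2 ^ (b + 2 * (c + 2)))⁻¹ := by
    rw [h, pow_add]
    push_cast
    field_simp
  rw [h3] at h1
  have h4 := h1 (by linarith [show (0 : ℝ) < (2 ^ (b + 2 * (c + 2)))⁻¹ by positivity])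
  have h5 : ((2 : ℝ) ^ (b + 2 * (c + 2)))⁻¹ < (2 ^ (c + 2 + 1 + c))⁻¹ := by
    apply inv_strictAnti₀ (by positivity)
    apply pow_lt_pow_right₀ (by norm_num)
    omega
  linarith

theorem haltingProbability_lt_one {U : List Bool →. List Bool}
    (hU : IsUniversalPrefixFreeMachine U) : haltingProbability U < 1 :=
  lt_of_le_of_ne (haltingProbability_le_one hU.1)
    (by simpa using haltingProbability_ne_dyadic hU 1 0)

theorem binVal_restrict_chaitinOmega {U : List Bool →. List Bool}
    (hU : IsUniversalPrefixFreeMachine U) (n : ℕ) :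
    binVal ((chaitinOmega U).restrict n) = ⌊haltingProbability U * 2 ^ n⌋₊ :=
  binVal_restrict_digits (haltingProbability_nonneg U) (haltingProbability_lt_one hU) n

/-! ### Randomness of the halting probability -/

/-- Turns an enumeration `f` of pairs `(i, σ)` into an enumeration of pairs `(i, τ)` such that, for
each `i`, the same open set is generated, but by a prefix-free set. The pair enumerated at `k` comes
from `f` at the first component of `k`, and `τ` is coded by the second component. -/
def disjointCover (f : ℕ → Option (ℕ × List Bool)) (k : ℕ) : Option (ℕ × List Bool) :=
  (decode₂ (List Bool) k.unpair.2).bind fun τ => (f k.unpair.1).bind fun q =>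
    if (q.2 <+: τ ∧ τ.length = k.unpair.1 + q.1) ∧ ∀ n < k.unpair.1,
      ((f n).map fun r => decide (r.1 = q.1 ∧ r.2 <+: τ)).getD false = false
    then some (q.1, τ) else none

theorem disjointCover_eq_some {f : ℕ → Option (ℕ × List Bool)} {k i : ℕ} {τ : List Bool} :
    disjointCover f k = some (i, τ) ↔ encode τ = k.unpair.2 ∧ τ.length = k.unpair.1 + i ∧
      (∃ σ, f k.unpair.1 = some (i, σ) ∧ σ <+: τ) ∧
      ∀ n < k.unpair.1, ∀ σ, f n = some (i, σ) → ¬ σ <+: τ := by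
  have key (τ : List Bool) (i n : ℕ) :
      ((f n).map fun r => decide (r.1 = i ∧ r.2 <+: τ)).getD false = false ↔
        ∀ σ, f n = some (i, σ) → ¬ σ <+: τ := by
    cases f n with
    | none => simp
    | some r =>
      obtain ⟨j, ρ⟩ := r
      simp only [Option.map_some, Option.getD_some, decide_eq_false_iff_not, not_and,
        Option.some_inj, Prod.mk.injEq]
      constructor
      · rintro h σ ⟨rfl, rfl⟩
        exact h rfl
      · rintro h rfl
        exact h ρ ⟨rfl, rfl⟩
  rw [disjointCover, Option.bind_eq_some_iff]
  constructor
  · rintro ⟨τ', h1, h2⟩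
    obtain ⟨⟨j, σ⟩, h3, h4⟩ := Option.bind_eq_some_iff.1 h2
    split_ifs at h4 with h5
    simp only [Option.some_inj, Prod.mk.injEq] at h4
    obtain ⟨rfl, rfl⟩ := h4
    exact ⟨mem_decode₂.1 h1, h5.1.2, ⟨σ, h3, h5.1.1⟩,
      fun n hn => (key _ _ n).1 (h5.2 n hn)⟩
  · rintro ⟨h1, h2, ⟨σ, h3, h4⟩, h5⟩
    refine ⟨τ, mem_decode₂.2 h1, Option.bind_eq_some_iff.2 ⟨(i, σ), h3, ?_⟩⟩
    exact if_pos ⟨⟨h4, h2⟩, fun n hn => (key _ _ n).2 (h5 n hn)⟩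

theorem primrec_disjointCover {f : ℕ → Option (ℕ × List Bool)} (hf : Primrec f) :
    Primrec (disjointCover f) := by
  have hk : Primrec fun y : (ℕ × List Bool) × (ℕ × List Bool) => y.1.1.unpair.1 :=
    Primrec.fst.comp (Primrec.unpair.comp (Primrec.fst.comp Primrec.fst))
  have hτ : Primrec fun y : (ℕ × List Bool) × (ℕ × List Bool) => y.1.2 :=
    Primrec.snd.comp Primrec.fst
  have hi : Primrec fun y : (ℕ × List Bool) × (ℕ × List Bool) => y.2.1 :=
    Primrec.fst.comp Primrec.snd
  have h1 : PrimrecRel fun (n : ℕ) (y : (ℕ × List Bool) × (ℕ × List Bool)) =>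
      ((f n).map fun r => decide (r.1 = y.2.1 ∧ r.2 <+: y.1.2)).getD false = false := by
    refine Primrec.eq.comp₂ (Primrec.option_getD.comp (Primrec.option_map (hf.comp Primrec.fst) ?_)
      (Primrec.const false)) (Primrec₂.const false)
    refine PrimrecPred.decide (PrimrecPred.and ?_ ?_)
    · exact Primrec.eq.comp (Primrec.fst.comp Primrec.snd)
        (hi.comp (Primrec.snd.comp Primrec.fst))
    · exact PrimrecRel.isPrefix.comp (Primrec.snd.comp Primrec.snd)
        (hτ.comp (Primrec.snd.comp Primrec.fst))
  have h2 : PrimrecPred fun y : (ℕ × List Bool) × (ℕ × List Bool) => ∀ n < y.1.1.unpair.1,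
      ((f n).map fun r => decide (r.1 = y.2.1 ∧ r.2 <+: y.1.2)).getD false = false :=
    (h1.forall_mem_list.comp (Primrec.list_range.comp hk) Primrec.id).of_eq fun y => by simp
  refine Primrec.option_bind (Primrec.decode₂.comp (Primrec.snd.comp Primrec.unpair)) ?_
  refine Primrec.option_bind (hf.comp (Primrec.fst.comp (Primrec.unpair.comp Primrec.fst))) ?_
  refine Primrec.ite (PrimrecPred.and (PrimrecPred.and ?_ ?_) h2)
    (Primrec.option_some.comp (Primrec.pair hi hτ)) (Primrec.const none)
  · exact PrimrecRel.isPrefix.comp (Primrec.snd.comp Primrec.snd) hτ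
  · exact Primrec.eq.comp (Primrec.list_length.comp hτ) (Primrec.nat_add.comp hk hi)

/-- A string `τ` enumerated for `i` at stage `n` has length `n + i`, so its weight `2 ^ (-n)` is its
measure times `2 ^ i`. The `i`-th component thus contributes at most `2 ^ i * 2 ^ (-(2 * i + 2))`,
and these sum to one half. -/
theorem tsum_disjointCover_le {f : ℕ → Option (ℕ × List Bool)} {T : ℕ → Set (List Bool)}
    (hf : ∀ n i σ, f n = some (i, σ) → σ ∈ T i)
    (hT : ∀ i, uniformMeasure (openOf (T i)) ≤ (2⁻¹ : ℝ≥0∞) ^ (2 * i + 2)) :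
    ∑' k : {k // (disjointCover f k).isSome}, (2⁻¹ : ℝ≥0∞) ^ k.1.unpair.1 ≤ 2⁻¹ := by
  set A : ℕ → Set (List Bool) := fun i => {τ | ∃ k, disjointCover f k = some (i, τ)} with hA
  have hpw (i) : (A i).Pairwise fun σ τ => ¬ σ <+: τ := by
    rintro τ ⟨k, hk⟩ τ' ⟨k', hk'⟩ hne hp
    obtain ⟨-, h1, ⟨σ, h2, h3⟩, -⟩ := disjointCover_eq_some.1 hk
    obtain ⟨-, h1', -, h4'⟩ := disjointCover_eq_some.1 hk'
    -- With `i` fixed, the shorter string comes from an earlier stage, and the longer one was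
    -- required to avoid that stage's cylinder.
    have hlen : τ.length < τ'.length :=
      lt_of_le_of_ne hp.length_le fun h => hne (hp.eq_of_length h)
    exact h4' _ (by omega) σ h2 (h3.trans hp)
  have hAT (i) : openOf (A i) ⊆ openOf (T i) := by
    refine Set.iUnion₂_subset fun τ hτ => ?_
    obtain ⟨k, hk⟩ := hτ
    obtain ⟨-, -, ⟨σ, h2, h3⟩, -⟩ := disjointCover_eq_some.1 hk
    exact (cylinder_subset_of_prefix h3).trans
      (Set.subset_biUnion_of_mem (u := cylinder) (hf _ _ _ h2))
  have hAm (i) : ∑' τ : A i, (2⁻¹ : ℝ≥0∞) ^ τ.1.length ≤ 2⁻¹ ^ (2 * i + 2) := by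
    rw [← uniformMeasure_openOf_of_pairwise (hpw i)]
    exact (MeasureTheory.measure_mono (hAT i)).trans (hT i)
  let e : {k // (disjointCover f k).isSome} → Σ i, A i := fun k =>
    ⟨((disjointCover f k.1).get k.2).1, ((disjointCover f k.1).get k.2).2, k.1, by simp⟩
  have hspec (k : {k // (disjointCover f k).isSome}) :
      disjointCover f k.1 = some ((e k).1, (e k).2.1) := by simp [e]
  have he : Function.Injective e := by
    intro k k' h
    have h1 := disjointCover_eq_some.1 (hspec k)
    have h2 := disjointCover_eq_some.1 (hspec k')
    rw [← h] at h2
    have h3 : k.1.unpair = k'.1.unpair := Prod.ext (by omega) (by omega)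
    exact Subtype.ext (by rw [← Nat.pair_unpair k.1, h3, Nat.pair_unpair])
  have h2 : (2 : ℝ≥0∞) * 2⁻¹ = 1 := ENNReal.mul_inv_cancel (by simp) (by simp)
  calc ∑' k : {k // (disjointCover f k).isSome}, (2⁻¹ : ℝ≥0∞) ^ k.1.unpair.1
      = ∑' k, (fun q : Σ i, A i => (2 : ℝ≥0∞) ^ q.1 * 2⁻¹ ^ q.2.1.length) (e k) := by
        refine tsum_congr fun k => ?_
        beta_reduce
        rw [(disjointCover_eq_some.1 (hspec k)).2.1, pow_add, mul_left_comm, ← mul_pow, h2,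
          one_pow, mul_one]
    _ ≤ ∑' q : Σ i, A i, (2 : ℝ≥0∞) ^ q.1 * 2⁻¹ ^ q.2.1.length :=
        ENNReal.tsum_comp_le_tsum_of_injective he _
    _ = ∑' i, (2 : ℝ≥0∞) ^ i * ∑' τ : A i, 2⁻¹ ^ τ.1.length := by
        rw [ENNReal.tsum_sigma']
        simp only [ENNReal.tsum_mul_left]
    _ ≤ ∑' i, (2⁻¹ : ℝ≥0∞) * 2⁻¹ ^ (i + 1) := by
        refine ENNReal.tsum_le_tsum fun i => (mul_le_mul_right (hAm i) _).trans_eq ?_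
        rw [show 2 * i + 2 = i + (i + 1 + 1) by ring, pow_add, ← mul_assoc, ← mul_pow, h2,
          one_pow, one_mul, pow_succ, mul_comm]
    _ = 2⁻¹ := by
        rw [ENNReal.tsum_mul_left, ENNReal.tsum_geometric_add_one, ENNReal.one_sub_inv_two, inv_inv,
          ENNReal.inv_mul_cancel (by simp) (by simp), mul_one]

/-- Chaitin's theorem. -/
theorem chaitinOmega_mem_MLR {U : List Bool →. List Bool}
    (hU : IsUniversalPrefixFreeMachine U) : chaitinOmega U ∈ MLR := by
  intro S hS hmem
  set X := chaitinOmega U with hX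
  have hre : REPred fun q : ℕ × List Bool => q.2 ∈ S (2 * q.1 + 2) := by
    have h1 : Computable fun q : ℕ × List Bool => (2 * q.1 + 2, q.2) :=
      (Primrec.pair (Primrec.nat_add.comp (Primrec.nat_mul.comp (Primrec.const 2) Primrec.fst)
        (Primrec.const 2)) Primrec.snd).to_comp
    exact Partrec.comp hS.1 h1
  obtain ⟨f, hf, hfS, hfe⟩ := hre.exists_enumeration
  set R := disjointCover f with hR
  have hRp : Primrec R := primrec_disjointCover hf
  -- Indices enumerating nothing become harmless requests for the empty string. Their weights `2 ^
  -- (-(k + 2))` use up the other half of the Kraft budget.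
  have hτp : Primrec fun k => ((R k).map Prod.snd).getD [] :=
    Primrec.option_getD.comp (Primrec.option_map hRp (Primrec.snd.comp Primrec.snd))
      (Primrec.const [])
  have hsum : ∑' k, (2⁻¹ : ℝ≥0∞) ^ (if (R k).isSome then k.unpair.1 else k + 2) ≤ 1 := by
    calc ∑' k, (2⁻¹ : ℝ≥0∞) ^ (if (R k).isSome then k.unpair.1 else k + 2)
        ≤ ∑' k, ({k | (R k).isSome}.indicator (fun k => (2⁻¹ : ℝ≥0∞) ^ k.unpair.1) k +
            2⁻¹ * 2⁻¹ ^ (k + 1)) := by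
          refine ENNReal.tsum_le_tsum fun k => ?_
          by_cases h : (R k).isSome
          · rw [if_pos h, Set.indicator_of_mem (show k ∈ {k | (R k).isSome} from h)]
            exact le_self_add
          · rw [if_neg h, pow_succ, mul_comm]
            exact le_add_self
      _ ≤ 2⁻¹ + 2⁻¹ := by
          rw [ENNReal.tsum_add, ← tsum_subtype]
          refine add_le_add (tsum_disjointCover_le (T := fun i => S (2 * i + 2))
            (fun n i σ h => (hfS (i, σ)).2 ⟨n, h⟩) fun i => hS.2 _) ?_
          rw [ENNReal.tsum_mul_left, ENNReal.tsum_geometric_add_one, ENNReal.one_sub_inv_two,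
            inv_inv, ENNReal.inv_mul_cancel (by simp) (by simp), mul_one]
      _ = 1 := ENNReal.inv_two_add_inv_two
  obtain ⟨c, hc⟩ := exists_gap_of_requests hU (m := fun k => if (R k).isSome then k.unpair.1
      else k + 2) (primrec_binVal.comp hτp) (Primrec.list_length.comp hτp)
    (Primrec.ite (Primrec.eq.comp (Primrec.option_isSome.comp hRp) (Primrec.const true))
      (Primrec.fst.comp Primrec.unpair) (Primrec.succ.comp Primrec.succ)) hsum
  -- With component `c + 2` the forced gap `2 ^ (-(n + c))` is four times the measure of the
  -- cylinder of length `n + (c + 2)`, while Ω lies less than two such units above the threshold.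
  have hex : ∃ n σ, f n = some (c + 2, σ) ∧ X ∈ cylinder σ := by
    obtain ⟨n, hn⟩ := mem_openOf.1 (Set.mem_iInter.1 hmem (2 * (c + 2) + 2))
    obtain ⟨l, hl⟩ := (hfS (c + 2, X.restrict n)).1 hn
    exact ⟨l, _, hl, mem_cylinder_restrict X n⟩
  classical
  -- At the first stage whose cylinder contains `X`, no earlier string covers the restriction of
  -- `X`, so `disjointCover` does enumerate that restriction.
  obtain ⟨σ, hσ, hXσ⟩ := Nat.find_spec hex
  have hmin := fun n => Nat.find_min hex (m := n)
  generalize Nat.find hex = n at hσ hmin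
  have hσn : σ.length ≤ n + (c + 2) :=
    (length_le_encode σ).trans ((Nat.right_le_pair _ _).trans ((hfe _ _ hσ).trans (by omega)))
  have hXτ := mem_cylinder_restrict X (n + (c + 2))
  have hRk : R (Nat.pair n (encode (X.restrict (n + (c + 2))))) =
      some (c + 2, X.restrict (n + (c + 2))) := by
    rw [hR, disjointCover_eq_some, Nat.unpair_pair]
    refine ⟨rfl, by simp, ⟨σ, hσ, prefix_of_mem_cylinder hXσ hXτ (by simpa using hσn)⟩, ?_⟩
    exact fun l hl ρ hρ hp => hmin l hl ⟨ρ, hρ, cylinder_subset_of_prefix hp hXτ⟩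
  have h1 := hc (Nat.pair n (encode (X.restrict (n + (c + 2)))))
  simp only [hRk, Option.map_some, Option.getD_some, Option.isSome_some, if_true,
    Nat.unpair_pair, Cantor.length_restrict] at h1
  rw [hX, binVal_restrict_chaitinOmega hU] at h1
  have h2 := Nat.floor_le (show 0 ≤ haltingProbability U * 2 ^ (n + (c + 2)) from
    mul_nonneg (haltingProbability_nonneg U) (by positivity))
  have h3 := Nat.lt_floor_add_one (haltingProbability U * 2 ^ (n + (c + 2)))
  generalize (⌊haltingProbability U * 2 ^ (n + (c + 2))⌋₊ : ℝ) = y at h1 h2 h3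
  have hpos : (0 : ℝ) < 2 ^ (n + (c + 2)) := by positivity
  rw [div_lt_iff₀ hpos] at h1
  have h4 := mul_le_mul_of_nonneg_right (h1 (by linarith)) hpos.le
  rw [add_mul, div_mul_cancel₀ _ hpos.ne', show n + (c + 2) = n + c + 2 by ring,
    pow_add _ (n + c), ← mul_assoc, inv_mul_cancel₀ (by positivity)] at h4
  rw [show n + (c + 2) = n + c + 2 by ring, pow_add _ (n + c)] at h3
  linarith

theorem zeros_notMem_MLR : Cantor.zeros ∉ MLR := by
  intro h
  refine h (fun i => {List.replicate i false}) ⟨?_, fun i => ?_⟩ (Set.mem_iInter.2 fun i => ?_)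
  · have : PrimrecPred fun p : ℕ × List Bool => p.2 ∈ ({List.replicate p.1 false} : Set _) :=
      Primrec.eq.comp Primrec.snd ((Primrec.list_replicate false).comp Primrec.fst)
    exact this.computablePred.to_re
  · simp [openOf, uniformMeasure_cylinder]
  · exact mem_openOf.2 ⟨i, by simp [Cantor.restrict_zeros]⟩

/-! ### Functionals given by c.e. trees -/

/-- The functional that outputs `0^n` on a string of length `n` in a c.e. set `T`. -/
def TuringFunctional.ofTree (T : Set (List Bool)) (hT : REPred fun σ => σ ∈ T) :
    TuringFunctional where
  pairs := {p | p.1 ∈ T ∧ p.2 = List.replicate p.1.length false}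
  ce := by
    obtain ⟨f, hf, hfT, -⟩ := hT.exists_enumeration
    have h1 : PrimrecRel fun (p : List Bool × List Bool) (n : ℕ) =>
        f n = some p.1 ∧ p.2 = List.replicate p.1.length false := by
      refine PrimrecPred.and ?_ ?_
      · exact Primrec.eq.comp (hf.comp Primrec.snd)
          (Primrec.option_some.comp (Primrec.fst.comp Primrec.fst))
      · exact Primrec.eq.comp (Primrec.snd.comp Primrec.fst) ((Primrec.list_replicate false).comp
          (Primrec.list_length.comp (Primrec.fst.comp Primrec.fst)))
    exact (REPred.of_exists h1).of_eq fun p => by simp [hfT]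
  consistent := by
    intro σ τ σ' τ' h1 h2 h
    have h1 : τ = List.replicate σ.length false := h1.2
    have h2 : τ' = List.replicate σ'.length false := h2.2
    rw [h1, h2]
    exact Or.inl (List.prefix_replicate_iff.2 (by simpa using h.length_le))

namespace TuringFunctional

variable {T : Set (List Bool)} {hT : REPred fun σ => σ ∈ T}

theorem mem_pairs_ofTree {σ τ : List Bool} : (σ, τ) ∈ (ofTree T hT).pairs ↔
    σ ∈ T ∧ τ = List.replicate σ.length false := Iff.rfl

theorem mem_toPFun_ofTree (hcl : ∀ σ τ, σ <+: τ → τ ∈ T → σ ∈ T) {X Y : Cantor} :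
    Y ∈ (ofTree T hT).toPFun X ↔ Y = Cantor.zeros ∧ ∀ n, X.restrict n ∈ T := by
  rw [mem_toPFun]
  constructor
  · refine fun h => ⟨Cantor.ext_restrict fun n => ?_, fun n => ?_⟩
    · obtain ⟨l, τ, h2, h3⟩ := h n
      rw [mem_pairs_ofTree] at h2
      rw [h2.2, List.prefix_replicate_iff] at h3
      simpa [Cantor.restrict_zeros] using h3.2
    · obtain ⟨l, τ, h2, h3⟩ := h n
      rw [mem_pairs_ofTree] at h2
      have hl : n ≤ l := by simpa [h2.2] using h3.length_le
      exact hcl _ _ (restrict_prefix X hl) h2.1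
  · rintro ⟨rfl, h⟩ n
    exact ⟨n, List.replicate n false, mem_pairs_ofTree.2 ⟨h n, by simp⟩,
      by simp [Cantor.restrict_zeros]⟩

theorem dom_ofTree (hcl : ∀ σ τ, σ <+: τ → τ ∈ T → σ ∈ T) :
    (ofTree T hT).dom = {X | ∀ n, X.restrict n ∈ T} := by
  ext X
  rw [dom, PFun.mem_dom]
  simp [mem_toPFun_ofTree hcl]

/-- The strings producing at least `0^n` are those of `T` of length at least `n`; by closure under
prefixes, level `n` already generates the same open set. -/
theorem induced_ofTree (hcl : ∀ σ τ, σ <+: τ → τ ∈ T → σ ∈ T) (n : ℕ) :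
    (ofTree T hT).induced (List.replicate n false) =
      {σ ∈ T | σ.length = n}.encard * (2⁻¹ : ℝ≥0∞) ^ n := by
  rw [← uniformMeasure_openOf_level (S := {σ ∈ T | σ.length = n}) fun σ hσ => hσ.2, induced]
  congr 1
  ext X
  rw [mem_openOf, mem_openOf]
  constructor
  · rintro ⟨l, τ, h1, h2⟩
    rw [mem_pairs_ofTree] at h2
    have hl : n ≤ l := by simpa [h2.2] using h1.length_le
    exact ⟨n, hcl _ _ (restrict_prefix X hl) h2.1, by simp⟩
  · rintro ⟨l, h1, h2⟩
    exact ⟨l, _, h2 ▸ List.prefix_rfl, mem_pairs_ofTree.2 ⟨h1, rfl⟩⟩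

theorem induced_ofTree_eq_zero {τ : List Bool} (hτ : τ ≠ List.replicate τ.length false) :
    (ofTree T hT).induced τ = 0 := by
  have : (ofTree T hT).preimage τ = ∅ := by
    refine Set.eq_empty_of_forall_notMem ?_
    rintro σ ⟨τ', h1, -, h3⟩
    refine hτ (List.eq_replicate_iff.2 ⟨rfl, fun b hb => ?_⟩)
    have := h1.subset hb
    rw [show τ' = _ from h3] at this
    exact List.eq_of_mem_replicate this
  simp [induced, this, openOf]

theorem induced_ofTree_congr {T' : Set (List Bool)} {hT' : REPred fun σ => σ ∈ T'}
    (hcl : ∀ σ τ, σ <+: τ → τ ∈ T → σ ∈ T) (hcl' : ∀ σ τ, σ <+: τ → τ ∈ T' → σ ∈ T')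
    (h : ∀ n, {σ ∈ T | σ.length = n}.encard = {σ ∈ T' | σ.length = n}.encard) :
    (ofTree T hT).induced = (ofTree T' hT').induced := by
  funext τ
  by_cases hτ : τ = List.replicate τ.length false
  · rw [hτ, induced_ofTree hcl, induced_ofTree hcl', h]
  · rw [induced_ofTree_eq_zero hτ, induced_ofTree_eq_zero hτ]

end TuringFunctional

/-! ### Two trees with the same level counts -/

theorem mem_of_prefix_of_concat {T : Set (List Bool)} (h : ∀ σ b, σ ++ [b] ∈ T → σ ∈ T)
    (σ τ : List Bool) (hp : σ <+: τ) (hτ : τ ∈ T) : σ ∈ T := by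
  obtain ⟨ρ, rfl⟩ := hp
  induction ρ using List.reverseRecOn with
  | nil => simpa using hτ
  | append_singleton ρ b ih =>
    rw [← List.append_assoc] at hτ
    exact ih (h _ _ hτ)

theorem encard_level_eq {T : Set (List Bool)} {V : Set ℕ} {n : ℕ}
    (h : ∀ σ : List Bool, σ.length = n → (σ ∈ T ↔ binVal σ ∈ V)) (hV : ∀ v ∈ V, v < 2 ^ n) :
    {σ ∈ T | σ.length = n}.encard = V.encard := by
  have h1 : binVal '' {σ ∈ T | σ.length = n} = V := by
    ext v
    constructor
    · rintro ⟨σ, ⟨h1, h2⟩, rfl⟩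
      exact (h σ h2).1 h1
    · intro hv
      obtain ⟨σ, h1, rfl⟩ := exists_binVal_eq n v (hV v hv)
      exact ⟨σ, ⟨(h σ h1).2 hv, h1⟩, rfl⟩
  rw [← h1, Set.InjOn.encard_image]
  intro σ hσ τ hτ heq
  exact binVal_injective_of_length (hσ.2.trans hτ.2.symm) heq

theorem exists_functionals {U : List Bool →. List Bool} (hU : IsUniversalPrefixFreeMachine U) :
    ∃ Φ Ψ : TuringFunctional, Φ.induced = Ψ.induced ∧
      Φ.dom = {chaitinOmega U} ∧ Cantor.zeros ∈ Φ.toPFun (chaitinOmega U) ∧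
      Ψ.dom = {Cantor.zeros} ∧ Cantor.zeros ∈ Ψ.toPFun Cantor.zeros := by
  obtain ⟨N, -, hN, -, hmono, hlim, -⟩ := exists_haltingProbability_approx hU.1
  have hdig := binVal_restrict_chaitinOmega hU
  have hne := haltingProbability_ne_dyadic hU
  have hlt1 := haltingProbability_lt_one hU
  have h0 := haltingProbability_nonneg U
  set Ω := haltingProbability U
  set X₀ := chaitinOmega U
  have hle (s : ℕ) : (N s : ℝ) / 2 ^ s ≤ Ω := hmono.ge_of_tendsto hlim s
  have hiff (v n : ℕ) : (∃ s, v * 2 ^ s < N s * 2 ^ n) ↔ (v : ℝ) < Ω * 2 ^ n := by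
    have h1 (s : ℕ) : v * 2 ^ s < N s * 2 ^ n ↔ (v : ℝ) / 2 ^ n < N s / 2 ^ s := by
      rw [div_lt_div_iff₀ (by positivity) (by positivity), ← Nat.cast_lt (α := ℝ)]
      push_cast
      rfl
    rw [← div_lt_iff₀ (by positivity)]
    simp only [h1]
    exact ⟨fun ⟨s, hs⟩ => hs.trans_le (hle s), fun h => (hlim.eventually (lt_mem_nhds h)).exists⟩
  have hnat (n v : ℕ) : Ω * 2 ^ n ≠ v := fun h => hne v n (by rw [← h]; field_simp)
  have hbound {n v : ℕ} (h : (v : ℝ) < Ω * 2 ^ n) : v < 2 ^ n := by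
    have : (v : ℝ) < 2 ^ n := h.trans_le (mul_le_of_le_one_left (by positivity) hlt1.le)
    exact_mod_cast this
  have hNle (n : ℕ) : (N n : ℝ) ≤ Ω * 2 ^ n := (div_le_iff₀ (by positivity)).1 (hle n)
  have hN2 (n : ℕ) : 2 * N n ≤ N (n + 1) := by
    have h1 := hmono n.le_succ
    simp only [Nat.succ_eq_add_one] at h1
    rw [div_le_div_iff₀ (by positivity) (by positivity), pow_succ] at h1
    have h2 : (0 : ℝ) < 2 ^ n := by positivity
    have : (2 * N n : ℝ) ≤ N (n + 1) := by nlinarith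
    exact_mod_cast this
  -- The existential over `s` expresses a strict upper bound by `Ω * 2 ^ σ.length` in a c.e. way,
  -- through `hiff`; likewise for `B`.
  set A : Set (List Bool) := {σ | ∃ s, N σ.length ≤ binVal σ ∧
    binVal σ * 2 ^ s < N s * 2 ^ σ.length}
  set B : Set (List Bool) := {σ | ∃ s, (binVal σ + N σ.length) * 2 ^ s < N s * 2 ^ σ.length}
  have hl : Primrec fun y : List Bool × ℕ => y.1.length := Primrec.list_length.comp Primrec.fst
  have hv : Primrec fun y : List Bool × ℕ => binVal y.1 := primrec_binVal.comp Primrec.fst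
  have h2s : Primrec fun y : List Bool × ℕ => 2 ^ y.2 :=
    Primrec.nat_pow.comp (Primrec.const 2) Primrec.snd
  have hNs : Primrec fun y : List Bool × ℕ => N y.2 * 2 ^ y.1.length :=
    Primrec.nat_mul.comp (hN.comp Primrec.snd) (Primrec.nat_pow.comp (Primrec.const 2) hl)
  have hA : REPred fun σ => σ ∈ A := REPred.of_exists (PrimrecPred.and
    (Primrec.nat_le.comp (hN.comp hl) hv) (Primrec.nat_lt.comp (Primrec.nat_mul.comp hv h2s) hNs))
  have hB : REPred fun σ => σ ∈ B := REPred.of_exists (Primrec.nat_lt.comp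
    (Primrec.nat_mul.comp (Primrec.nat_add.comp hv (hN.comp hl)) h2s) hNs)
  have hAm (σ) : σ ∈ A ↔ N σ.length ≤ binVal σ ∧ (binVal σ : ℝ) < Ω * 2 ^ σ.length := by
    rw [← hiff]
    exact exists_and_left
  have hBm (σ) : σ ∈ B ↔ ((binVal σ + N σ.length : ℕ) : ℝ) < Ω * 2 ^ σ.length := (hiff _ _)
  have hAcl := mem_of_prefix_of_concat (T := A) fun σ b h => by
    rw [hAm, binVal_concat, List.length_append, List.length_singleton, pow_succ] at h
    rw [hAm]
    have h1 := hN2 σ.length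
    have h2 := Bool.toNat_le b
    refine ⟨by omega, ?_⟩
    have h3 := h.2
    push_cast at h3
    linarith [show (0 : ℝ) ≤ b.toNat from Nat.cast_nonneg _]
  have hBcl := mem_of_prefix_of_concat (T := B) fun σ b h => by
    rw [hBm, binVal_concat, List.length_append, List.length_singleton, pow_succ] at h
    rw [hBm]
    have h1 : (2 * N σ.length : ℝ) ≤ N (σ.length + 1) := by exact_mod_cast hN2 σ.length
    push_cast at h ⊢
    linarith [show (0 : ℝ) ≤ b.toNat from Nat.cast_nonneg _]
  have hdomA (X : Cantor) : (∀ n, X.restrict n ∈ A) ↔ X = X₀ := by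
    constructor
    · refine fun h => Cantor.ext_restrict fun n => binVal_injective_of_length (by simp) ?_
      have h1 := (hAm _).1 (h n)
      rw [Cantor.length_restrict] at h1
      rw [hdig, eq_comm, Nat.floor_eq_iff (by positivity)]
      -- Each lower bound on a longer restriction of `X` keeps `N l / 2 ^ l` below the right
      -- endpoint of the cylinder. The limit gives only ≤, and non-dyadicity makes it strict.
      refine ⟨h1.2.le, lt_of_le_of_ne ?_ (by exact_mod_cast hnat n (binVal (X.restrict n) + 1))⟩
      rw [← le_div_iff₀ (by positivity)]
      refine le_of_tendsto hlim ((eventually_ge_atTop n).mono fun l hl => ?_)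
      have h2 := (binVal_prefix (TuringFunctional.restrict_prefix X hl)).2
      have h3 := ((hAm _).1 (h l)).1
      simp only [Cantor.length_restrict] at h2 h3
      rw [div_le_div_iff₀ (by positivity) (by positivity)]
      exact_mod_cast (Nat.mul_le_mul_right _ h3).trans h2.le
    · rintro rfl n
      rw [hAm, Cantor.length_restrict, hdig]
      exact ⟨Nat.le_floor (hNle n), lt_of_le_of_ne (Nat.floor_le (by positivity)) (hnat n _).symm⟩
  have hdomB (X : Cantor) : (∀ n, X.restrict n ∈ B) ↔ X = Cantor.zeros := by
    constructor
    · refine fun h => Cantor.eq_zeros_of_binVal fun n => ?_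
      have h1 : Tendsto (fun s => Ω - (N s : ℝ) / 2 ^ s) atTop (𝓝 (Ω - Ω)) :=
        tendsto_const_nhds.sub hlim
      rw [sub_self] at h1
      -- The value of `X.restrict n` is at most that of every longer restriction, hence at most `Ω -
      -- N l / 2 ^ l`, which tends to 0.
      have h2 : (binVal (X.restrict n) : ℝ) / 2 ^ n ≤ 0 := by
        refine ge_of_tendsto h1 ((eventually_ge_atTop n).mono fun l hl => ?_)
        have h2 := (binVal_prefix (TuringFunctional.restrict_prefix X hl)).1
        have h3 := (hBm _).1 (h l)
        simp only [Cantor.length_restrict] at h2 h3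
        push_cast at h3
        have h4 : (binVal (X.restrict n) : ℝ) / 2 ^ n ≤ binVal (X.restrict l) / 2 ^ l := by
          rw [div_le_div_iff₀ (by positivity) (by positivity)]
          exact_mod_cast h2
        refine h4.trans ?_
        rw [le_sub_iff_add_le, ← add_div, div_le_iff₀ (by positivity)]
        exact h3.le
      have h3 := (div_le_iff₀ (by positivity)).1 h2
      rw [zero_mul] at h3
      exact_mod_cast le_antisymm h3 (Nat.cast_nonneg _)
    · rintro rfl n
      rw [hBm, Cantor.length_restrict, Cantor.restrict_zeros, binVal_replicate_false, zero_add]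
      exact lt_of_le_of_ne (hNle n) (hnat n _).symm
  refine ⟨.ofTree A hA, .ofTree B hB, TuringFunctional.induced_ofTree_congr hAcl hBcl fun n => ?_,
    ?_, ?_, ?_, ?_⟩
  · rw [encard_level_eq (T := A) (V := {v | N n ≤ v ∧ (v : ℝ) < Ω * 2 ^ n})
        (fun σ hσ => by rw [hAm, hσ]; rfl) fun v hv => hbound hv.2,
      encard_level_eq (T := B) (V := {v | ((v + N n : ℕ) : ℝ) < Ω * 2 ^ n})
        (fun σ hσ => by rw [hBm, hσ]; rfl) fun v hv => (Nat.le_add_right _ _).trans_lt (hbound hv)]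
    -- Translation by `N n` carries level `n` of `B` onto level `n` of `A`.
    rw [← (add_left_injective (N n)).encard_image {v | ((v + N n : ℕ) : ℝ) < Ω * 2 ^ n}]
    congr 1
    ext v
    constructor
    · rintro ⟨h1, h2⟩
      refine ⟨v - N n, ?_, Nat.sub_add_cancel h1⟩
      rwa [Set.mem_ofPred_eq, Nat.sub_add_cancel h1]
    · rintro ⟨w, hw, rfl⟩
      exact ⟨Nat.le_add_left _ _, hw⟩
  · rw [TuringFunctional.dom_ofTree hAcl]
    exact Set.ext hdomA
  · exact (TuringFunctional.mem_toPFun_ofTree hAcl).2 ⟨rfl, (hdomA _).2 rfl⟩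
  · rw [TuringFunctional.dom_ofTree hBcl]
    exact Set.ext hdomB
  · exact (TuringFunctional.mem_toPFun_ofTree hBcl).2 ⟨rfl, (hdomB _).2 rfl⟩

end

theorem mainTheorem3 :
    (∃ Φ Ψ : TuringFunctional, Φ.induced = Ψ.induced ∧ Φ.image MLR ≠ Ψ.image MLR) ∧
    (∃ U : List Bool →. List Bool, IsUniversalPrefixFreeMachine U) ∧
    (∀ U : List Bool →. List Bool, IsUniversalPrefixFreeMachine U →
      ∃ Φ Ψ : TuringFunctional, Φ.induced = Ψ.induced ∧
        Φ.dom = {chaitinOmega U} ∧ Cantor.zeros ∈ Φ.toPFun (chaitinOmega U) ∧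
        Ψ.dom = {Cantor.zeros} ∧ Cantor.zeros ∈ Ψ.toPFun Cantor.zeros ∧
        Φ.image MLR ≠ Ψ.image MLR) := by
  have key : ∀ U : List Bool →. List Bool, IsUniversalPrefixFreeMachine U →
      ∃ Φ Ψ : TuringFunctional, Φ.induced = Ψ.induced ∧
        Φ.dom = {chaitinOmega U} ∧ Cantor.zeros ∈ Φ.toPFun (chaitinOmega U) ∧
        Ψ.dom = {Cantor.zeros} ∧ Cantor.zeros ∈ Ψ.toPFun Cantor.zeros ∧
        Φ.image MLR ≠ Ψ.image MLR := by
    intro U hU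
    obtain ⟨Φ, Ψ, h1, h2, h3, h4, h5⟩ := exists_functionals hU
    refine ⟨Φ, Ψ, h1, h2, h3, h4, h5, fun h => ?_⟩
    have hΦ : Cantor.zeros ∈ Φ.image MLR := ⟨_, chaitinOmega_mem_MLR hU, h3⟩
    rw [h] at hΦ
    obtain ⟨X, hX, hX2⟩ := hΦ
    have hXd : X ∈ Ψ.dom := (PFun.mem_dom _ _).2 ⟨_, hX2⟩
    rw [h4, Set.mem_singleton_iff] at hXd
    exact zeros_notMem_MLR (hXd ▸ hX)
  refine ⟨?_, exists_isUniversalPrefixFreeMachine, key⟩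
  obtain ⟨U, hU⟩ := exists_isUniversalPrefixFreeMachine
  obtain ⟨Φ, Ψ, h1, -, -, -, -, h2⟩ := key U hU
  exact ⟨Φ, Ψ, h1, h2⟩
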